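/- Let $\mathbb F_q$ be the finite field with $q$ elements, of characteristic $p$, and let $n\ge 0$. Let $\mathrm{AGL}(n,\mathbb F_q)$ be the group of matrices $\left[\begin{smallmatrix}A&0\\a&1\end{smallmatrix}\right]$ with $A\in\mathrm{GL}(n,\mathbb F_q)$, $a\in\mathbb F_q^n$, acting on the set of all functions $f:\mathbb F_q^n\to\mathbb F_q$ by $f(x)\mapsto f(xA+a)$, and let $\mathfrak N_{q,n}$ be the number of orbits. *Notation.* A partition is a sequence $\lambda=(\lambda_1,\lambda_2,\dots)$ of nonnegative integers with finitely many nonzero terms; $|\lambda|=\sum_i i\lambda_i$, $T(\lambda)=\{i:\lambda_i>0\}$, and $\mathfrak m(\lambda)=\max T(\lambda)$ (with $\max\emptyset=0$). Partitions are totally ordered: $\lambda<\eta$ means that $|\lambda|<|\eta|$, or that $|\lambda|=|\eta|$ and $\lambda_i<\eta_i$ for the largest $i$ with $\lambda_i\neq\eta_i$. Let $D=\{d>1: d\mid q^i-1\text{ for some }1\le i\le n\}$. For $d\in D$ let $o_d(q)$ be the multiplicative order of $q$ modulo $d$, let $\psi(d)=\phi(d)/o_d(q)$ with $\phi$ Euler's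 function, and let $\Lambda_d$ be the set of tuples $\boldsymbol\lambda=(\boldsymbol\lambda^{(1)},\dots,\boldsymbol\lambda^{(\psi(d))})$ of partitions with $\boldsymbol\lambda^{(1)}\le\dots\le\boldsymbol\lambda^{(\psi(d))}$. For such a tuple put $|\boldsymbol\lambda|=\sum_i|\boldsymbol\lambda^{(i)}|$, $\mathfrak m(\boldsymbol\lambda)=\max_i\mathfrak m(\boldsymbol\lambda^{(i)})$ and $s(\boldsymbol\lambda)=\psi(d)!/(k_1!\cdots k_r!)$, where $k_1,\dots,k_r$ are the multiplicities of the distinct components of $\boldsymbol\lambda$. Let $\Omega$ be the (finite) set of all $\omega=(\lambda,(\boldsymbol\lambda_d)_{d\in D})$ with $\lambda$ a partition, $\boldsymbol\lambda_d\in\Lambda_d$, and $|\lambda|+\sum_{d\in D}o_d(q)|\boldsymbol\lambda_d|=n$. Write $\boldsymbol\lambda_d^{(i)}=(\boldsymbol\lambda_{d,1}^{(i)},\boldsymbol\lambda_{d,2}^{(i)},\dots)$, and let $\nu$ be the $p$-adic valuation. For $\omega\in\Omega$ and $t\in T(\lambda)$ define $$E(\omega)=\sum_{j,k}\min(j,k)\lambda_j\lambda_k+\sum_{d\in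 D}o_d(q)\sum_{i=1}^{\psi(d)}\sum_{j,k}\min(j,k)\boldsymbol\lambda_{d,j}^{(i)}\boldsymbol\lambda_{d,k}^{(i)},$$ $$P(\omega)=\prod_j\prod_{l=1}^{\lambda_j}(1-q^{-l})\cdot\prod_{d\in D}\prod_{i=1}^{\psi(d)}\prod_j\prod_{u=1}^{\boldsymbol\lambda_{d,j}^{(i)}}\bigl(1-q^{-o_d(q)u}\bigr),$$ $$a_1(\omega)=q^{\sum_j\lambda_j+E(\omega)}P(\omega),\qquad a_2(t,\omega)=\frac{1}{q^{\lambda_t}-1}\,q^{\sum_{j\ge t}\lambda_j+E(\omega)}P(\omega),$$ $$b_1(\omega)=\operatorname{lcm}\{d\in D:|\boldsymbol\lambda_d|>0\}\cdot p^{\lceil\log_p\max(\{\mathfrak m(\lambda)\}\cup\{\mathfrak m(\boldsymbol\lambda_d):d\in D\})\rceil},$$ with $\operatorname{lcm}\emptyset=1$ and, if the maximum is $0$ (only when $n=0$), the second factor read as $1$; $$b_2(t,\omega)=b_1(\omega)\cdot\begin{cases}p&\text{if }t=\mathfrak m(\lambda)\ge\mathfrak m(\boldsymbol\lambda_d)\text{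 for all }d\in D\text{ and }t=p^m\text{ for some }m\ge0,\\1&\text{otherwise;}\end{cases}$$ $$w(k,\omega)=\sum_{j}\min(p^{\nu(k)},j)\lambda_j+\sum_{d\in D,\ d\mid k}o_d(q)\sum_{i=1}^{\psi(d)}\sum_{j}\min(p^{\nu(k)},j)\boldsymbol\lambda_{d,j}^{(i)},$$ $$e_1(\omega)=\frac1{b_1(\omega)}\sum_{k\mid b_1(\omega)}\phi\bigl(b_1(\omega)/k\bigr)q^{w(k,\omega)},\qquad e_2(t,\omega)=\frac1{b_2(t,\omega)}\sum_{\substack{k\mid b_2(t,\omega)\\ \nu(k)\ge1+\lfloor\log_pt\rfloor}}\phi\bigl(b_2(t,\omega)/k\bigr)q^{w(k,\omega)}.$$ **Theorem.** $$\mathfrak N_{q,n}=\sum_{\omega\in\Omega}\Bigl(\prod_{d\in D}s(\boldsymbol\lambda_d)\Bigr)\frac{q^{e_1(\omega)}}{a_1(\omega)}+\sum_{\omega\in\Omega}\ \sum_{t\in T(\lambda)}\Bigl(\prod_{d\in D}s(\boldsymbol\lambda_d)\Bigr)\frac{q^{e_2(t,\omega)}}{a_2(t,\omega)}.$$ For $q=2$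 this is the number of affine equivalence classes of Boolean functions in $n$ variables. -/

import Mathlib

namespace AGLCount

section Group

open Matrix

variable {n : ℕ} {F : Type*} [Field F]

/-- The affine linear group `AGL(n, F)`: the invertible `(n+1) × (n+1)` matrices of the block form
`[A 0; a 1]` with `A ∈ GL(n, F)` and `a ∈ F ^ n` a row vector. -/
def AGL (n : ℕ) (F : Type*) [Field F] : Subgroup (GL (Fin n ⊕ Unit) F) where
  carrier := {g | ∃ (A : GL (Fin n) F) (a : Fin n → F),
    (g : Matrix (Fin n ⊕ Unit) (Fin n ⊕ Unit) F) =
      fromBlocks (A : Matrix (Fin n) (Fin n) F) 0 (replicateRow Unit a) 1}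
  one_mem' := by
    refine ⟨1, 0, ?_⟩
    have h : replicateRow Unit (0 : Fin n → F) = 0 := by ext i j; rfl
    rw [h]
    simp
  mul_mem' := by
    rintro g h ⟨A, a, hg⟩ ⟨B, b, hh⟩
    refine ⟨A * B, a ᵥ* (B : Matrix (Fin n) (Fin n) F) + b, ?_⟩
    rw [Units.val_mul, hg, hh, fromBlocks_multiply]
    simp [replicateRow_add, replicateRow_vecMul]
  inv_mem' := by
    rintro g ⟨A, a, hg⟩
    refine ⟨A⁻¹, -(a ᵥ* ((A⁻¹ : GL (Fin n) F) : Matrix (Fin n) (Fin n) F)), ?_⟩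
    apply Units.inv_eq_of_mul_eq_one_right
    have h : replicateRow Unit (-(a ᵥ* ((A⁻¹ : GL (Fin n) F) : Matrix (Fin n) (Fin n) F))) =
        -(replicateRow Unit a * ((A⁻¹ : GL (Fin n) F) : Matrix (Fin n) (Fin n) F)) := by
      rw [← replicateRow_vecMul]; ext i j; rfl
    rw [hg, h, fromBlocks_multiply, ← Units.val_mul]
    simp

/-- The linear part `A` of `[A 0; a 1]`. -/
def linPart (g : AGL n F) : Matrix (Fin n) (Fin n) F :=
  (g : GL (Fin n ⊕ Unit) F).val.toBlocks₁₁

/-- The translation part `a` of `[A 0; a 1]`. -/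
def transPart (g : AGL n F) : Fin n → F :=
  (g : GL (Fin n ⊕ Unit) F).val.toBlocks₂₁ ()

/-- The affine map `x ↦ x A + a` given by `[A 0; a 1]`, on row vectors `x`. -/
def affMap (g : AGL n F) (x : Fin n → F) : Fin n → F :=
  x ᵥ* linPart g + transPart g

theorem val_eq (g : AGL n F) :
    (g : GL (Fin n ⊕ Unit) F).val =
      fromBlocks (linPart g) 0 (replicateRow Unit (transPart g)) 1 := by
  obtain ⟨A, a, h⟩ := g.2
  simp only [linPart, transPart]
  rw [h]
  rfl

theorem affMap_one (x : Fin n → F) : affMap (1 : AGL n F) x = x := by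
  have h1 : linPart (1 : AGL n F) = 1 := by
    ext i j; simp [linPart, toBlocks₁₁, Matrix.one_apply]
  have h2 : transPart (1 : AGL n F) = 0 := by
    ext i; simp [transPart, toBlocks₂₁]
  simp [affMap, h1, h2]

theorem affMap_mul (g h : AGL n F) (x : Fin n → F) :
    affMap (g * h) x = affMap h (affMap g x) := by
  have key := val_eq (g * h)
  rw [Subgroup.coe_mul, Units.val_mul, val_eq g, val_eq h, fromBlocks_multiply] at key
  have h1 : linPart (g * h) = linPart g * linPart h := by
    simpa using (congrArg toBlocks₁₁ key).symm
  have h2 : transPart (g * h) = transPart g ᵥ* linPart h + transPart h := by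
    have := congrFun (congrArg toBlocks₂₁ key).symm ()
    rw [toBlocks_fromBlocks₂₁, toBlocks_fromBlocks₂₁, ← replicateRow_vecMul] at this
    ext i
    simpa using congrFun this i
  simp [affMap, h1, h2, add_vecMul, add_assoc]

/-- `AGL(n, F)` acts on the functions `F ^ n → F` by `γ(f)(x) = f(x A + a)`. -/
instance : MulAction (AGL n F) ((Fin n → F) → F) where
  smul g f := fun x => f (affMap g x)
  one_smul f := funext fun x => congrArg f (affMap_one x)
  mul_smul g h f := funext fun x => congrArg f (affMap_mul g h x)

/-- The number of orbits of `AGL(n, F)` on the set of all functions `F ^ n → F`. -/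
noncomputable def numOrbits (n : ℕ) (F : Type*) [Field F] : ℕ :=
  Nat.card (MulAction.orbitRel.Quotient (AGL n F) ((Fin n → F) → F))

end Group

section Partitions

/-- A partition is a finitely supported sequence `lam = (lam 1, lam 2, …)` of nonnegative integers;
`lam i` is the multiplicity of the part `i`. Its set `T(lam) = {i : lam i > 0}` is `lam.support`. -/
abbrev Ptn : Type := ℕ+ →₀ ℕ

/-- `|lam| = ∑ i * lam i`. -/
def Ptn.size (lam : Ptn) : ℕ := lam.sum fun i m => (i : ℕ) * m

/-- The largest `i` with `lam i > 0` (and `0` if there is none). -/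
def Ptn.top (lam : Ptn) : ℕ := lam.support.sup fun i => (i : ℕ)

/-- The order on partitions: first by size, then by the entry at the largest index where the two
sequences differ. -/
def Ptn.Less (lam eta : Ptn) : Prop :=
  lam.size < eta.size ∨
    (lam.size = eta.size ∧ ∃ i, lam i < eta i ∧ ∀ j, i < j → lam j = eta j)

/-- `∑ lam j`. -/
def Ptn.len (lam : Ptn) : ℕ := lam.sum fun _ m => m

/-- `∑_{j ≥ t} lam j`. -/
def Ptn.lenFrom (t : ℕ+) (lam : Ptn) : ℕ := ∑ j ∈ lam.support with t ≤ j, lam j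

/-- `∑_{j,k} min(j,k) * lam j * lam k`. -/
def Ptn.quad (lam : Ptn) : ℕ :=
  ∑ j ∈ lam.support, ∑ k ∈ lam.support, min (j : ℕ) (k : ℕ) * lam j * lam k

/-- `∑_j min(m,j) * lam j`. -/
def Ptn.minSum (m : ℕ) (lam : Ptn) : ℕ := ∑ j ∈ lam.support, min m (j : ℕ) * lam j

/-- `∏_j ∏_{1 ≤ u ≤ lam j} (1 - q ^ (-c u))`. -/
noncomputable def Ptn.euler (q c : ℕ) (lam : Ptn) : ℝ :=
  ∏ j ∈ lam.support, ∏ u ∈ Finset.Icc 1 (lam j), (1 - (q : ℝ) ^ (-((c * u : ℕ) : ℤ)))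

end Partitions

section Data

/-- `o_d(q)`, the multiplicative order of `q` modulo `d`. -/
noncomputable def ordMod (q d : ℕ) : ℕ := orderOf (q : ZMod d)

/-- `ψ(d) = φ(d) / o_d(q)` (an exact division when `d` is coprime to `q`). -/
noncomputable def psi (q d : ℕ) : ℕ := Nat.totient d / ordMod q d

/-- `D = {d > 1 : d ∣ q ^ i - 1 for some 1 ≤ i ≤ n}`. -/
def D (q n : ℕ) : Finset ℕ :=
  ((Finset.Icc 1 n).biUnion fun i => (q ^ i - 1).divisors).filter fun d => 1 < d

/-- For `q ≥ 2`, membership in `D` is the condition one expects. -/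
theorem mem_D {q n d : ℕ} (hq : 2 ≤ q) :
    d ∈ D q n ↔ 1 < d ∧ ∃ i, 1 ≤ i ∧ i ≤ n ∧ d ∣ q ^ i - 1 := by
  simp only [D, Finset.mem_filter, Finset.mem_biUnion, Finset.mem_Icc, Nat.mem_divisors]
  constructor
  · rintro ⟨⟨i, ⟨h1, h2⟩, h3, -⟩, h4⟩
    exact ⟨h4, i, h1, h2, h3⟩
  · rintro ⟨h4, i, h1, h2, h3⟩
    have := Nat.one_lt_pow (by omega : i ≠ 0) (by omega : 1 < q)
    exact ⟨⟨i, ⟨h1, h2⟩, h3, by omega⟩, h4⟩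

/-- `|Lam| = ∑ |Lam i|` for a tuple of partitions. -/
def tupSize {r : ℕ} (Lam : Fin r → Ptn) : ℕ := ∑ i, (Lam i).size

/-- The largest part occurring in a tuple of partitions (and `0` if there is none). -/
def tupTop {r : ℕ} (Lam : Fin r → Ptn) : ℕ := Finset.univ.sup fun i => (Lam i).top

/-- The set of weakly increasing tuples of `ψ(d)` partitions. -/
def LamSet (q d : ℕ) : Set (Fin (psi q d) → Ptn) :=
  {Lam | ∀ i j, i < j → Lam i = Lam j ∨ (Lam i).Less (Lam j)}

/-- The number of distinct rearrangements of a tuple, `r! / (k₁! ⋯ k_t!)`, where `k₁, …, k_t` are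
the multiplicities of its distinct components. -/
def numPerm {r : ℕ} (Lam : Fin r → Ptn) : ℕ :=
  Nat.factorial r / ∏ mu ∈ Finset.univ.image Lam,
    Nat.factorial (Finset.univ.filter fun i => Lam i = mu).card

/-- Pairs `(lam, (Lam_d)_{d ∈ D})`: a partition and, for each `d ∈ D`, a `ψ(d)`-tuple of
partitions. -/
abbrev Datum (q n : ℕ) : Type := Ptn × ((d : D q n) → (Fin (psi q d) → Ptn))

/-- `Ω`: the pairs with all `Lam_d` weakly increasing and
`|lam| + ∑_{d ∈ D} o_d(q) |Lam_d| = n`. -/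
def Omega (q n : ℕ) : Set (Datum q n) :=
  {w | (∀ d : D q n, w.2 d ∈ LamSet q d) ∧
    w.1.size + ∑ d : D q n, ordMod q d * tupSize (w.2 d) = n}

theorem ordMod_pos {q n d : ℕ} (hd : d ∈ D q n) : 0 < ordMod q d := by
  simp only [D, Finset.mem_filter, Finset.mem_biUnion, Finset.mem_Icc, Nat.mem_divisors] at hd
  obtain ⟨⟨i, ⟨h1, -⟩, h2, h3⟩, -⟩ := hd
  rw [ordMod, orderOf_pos_iff, isOfFinOrder_iff_pow_eq_one]
  refine ⟨i, h1, ?_⟩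
  have h := (ZMod.natCast_eq_zero_iff (q ^ i - 1) d).2 h2
  rw [Nat.cast_sub (by omega)] at h
  simpa [sub_eq_zero] using h

theorem finite_size_le (n : ℕ) : {lam : Ptn | lam.size ≤ n}.Finite := by
  let s : Finset ℕ+ := Finset.Icc 1 n.succPNat
  let f : Ptn := Finsupp.onFinset s (fun i => if i ∈ s then n else 0)
    (by intro i hi; by_contra h; simp [h] at hi)
  refine (Set.finite_Iic f).subset ?_
  intro lam hlam i
  rcases Nat.eq_zero_or_pos (lam i) with h0 | h0
  · rw [h0]; exact Nat.zero_le _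
  · have h1 : (i : ℕ) * lam i ≤ lam.size :=
      Finset.single_le_sum (f := fun i : ℕ+ => (i : ℕ) * lam i) (fun _ _ => Nat.zero_le _)
        (Finsupp.mem_support_iff.2 h0.ne')
    have h2 : (i : ℕ) * lam i ≤ n := h1.trans hlam
    have h3 : (i : ℕ) ≤ n := (Nat.le_mul_of_pos_right _ h0).trans h2
    have h4 : lam i ≤ n := (Nat.le_mul_of_pos_left _ i.pos).trans h2
    have h5 : i ∈ s := by
      refine Finset.mem_Icc.2 ⟨one_le, ?_⟩
      exact (PNat.coe_le_coe i n.succPNat).1 (h3.trans (Nat.le_succ n))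
    simpa [f, h5] using h4

theorem Omega_finite (q n : ℕ) : (Omega q n).Finite := by
  refine ((finite_size_le n).prod (Set.Finite.pi fun d : D q n =>
    Set.Finite.pi fun _ : Fin (psi q d) => finite_size_le n)).subset ?_
  rintro w ⟨-, hw⟩
  refine ⟨by simp only [Set.mem_ofPred_eq]; omega, ?_⟩
  intro d _ i _
  have h1 : (w.2 d i).size ≤ tupSize (w.2 d) :=
    Finset.single_le_sum (f := fun i => (w.2 d i).size) (fun _ _ => Nat.zero_le _)
      (Finset.mem_univ i)
  have h2 : tupSize (w.2 d) ≤ ordMod q d * tupSize (w.2 d) :=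
    Nat.le_mul_of_pos_left _ (ordMod_pos d.2)
  have h3 : ordMod q d * tupSize (w.2 d) ≤ ∑ d : D q n, ordMod q d * tupSize (w.2 d) :=
    Finset.single_le_sum (f := fun d : D q n => ordMod q d * tupSize (w.2 d))
      (fun _ _ => Nat.zero_le _) (Finset.mem_univ d)
  simp only [Set.mem_ofPred_eq]
  omega

/-- The set `Ω` as a finite set. -/
noncomputable def OmegaFin (q n : ℕ) : Finset (Datum q n) := (Omega_finite q n).toFinset

end Data

section Formula

variable {q n : ℕ}

/-- `∏_{d ∈ D} s(Lam_d)`. -/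
noncomputable def mult (w : Datum q n) : ℕ := ∏ d : D q n, numPerm (w.2 d)

/-- `∑_{j,k} min(j,k) lam_j lam_k + ∑_d o_d(q) ∑_i ∑_{j,k} min(j,k) Lam_{d,j}^i Lam_{d,k}^i`. -/
noncomputable def quadTotal (w : Datum q n) : ℕ :=
  w.1.quad + ∑ d : D q n, ordMod q d * ∑ i, (w.2 d i).quad

/-- `(∏_j ∏_{l ≤ lam_j} (1 - q ^ (-l))) *
(∏_d ∏_i ∏_j ∏_{u ≤ Lam_{d,j}^i} (1 - q ^ (-o_d(q) u)))`. -/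
noncomputable def eulerTotal (w : Datum q n) : ℝ :=
  w.1.euler q 1 * ∏ d : D q n, ∏ i, (w.2 d i).euler q (ordMod q d)

/-- `q ^ (∑ lam_j + quadTotal) * eulerTotal`. -/
noncomputable def a1 (w : Datum q n) : ℝ :=
  (q : ℝ) ^ (w.1.len + quadTotal w) * eulerTotal w

/-- `(q ^ lam_t - 1)⁻¹ * q ^ (∑_{j ≥ t} lam_j + quadTotal) * eulerTotal`. -/
noncomputable def a2 (t : ℕ+) (w : Datum q n) : ℝ :=
  1 / ((q : ℝ) ^ w.1 t - 1) * (q : ℝ) ^ (w.1.lenFrom t + quadTotal w) * eulerTotal w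

/-- The largest part occurring in any of the partitions `Lam_d^i`. -/
noncomputable def topD (w : Datum q n) : ℕ := Finset.univ.sup fun d : D q n => tupTop (w.2 d)

/-- `lcm{d : |Lam_d| > 0} * p ^ ⌈log_p M⌉`, where `M` is the largest part occurring in `w`.
`Nat.clog p M` is `⌈log_p M⌉` for `M ≥ 1`, and it is `0` for `M = 0` (which happens only if
`n = 0`, for `w` in `Ω`). -/
noncomputable def b1 (p : ℕ) (w : Datum q n) : ℕ :=
  (Finset.univ.filter fun d : D q n => 0 < tupSize (w.2 d)).lcm (fun d => (d : ℕ)) *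
    p ^ Nat.clog p (max w.1.top (topD w))

open Classical in
/-- `b₁` times `p` if `t` is the largest part of `lam`, at least all the parts of the `Lam_d^i`,
and a power of `p`, and `b₁` times `1` otherwise. Here `1 = p ^ 0` counts as a power of `p`. -/
noncomputable def b2 (p : ℕ) (t : ℕ+) (w : Datum q n) : ℕ :=
  b1 p w *
    if (t : ℕ) = w.1.top ∧ topD w ≤ w.1.top ∧ ∃ m : ℕ, (t : ℕ) = p ^ m then p else 1

/-- `∑_j min(p^ν(k), j) lam_j + ∑_{d ∈ D, d ∣ k} o_d(q) ∑_i ∑_j min(p^ν(k), j) Lam_{d,j}^i`. -/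
noncomputable def fixExp (p k : ℕ) (w : Datum q n) : ℕ :=
  w.1.minSum (p ^ padicValNat p k) +
    ∑ d ∈ Finset.univ.filter (fun d : D q n => (d : ℕ) ∣ k),
      ordMod q d * ∑ i, (w.2 d i).minSum (p ^ padicValNat p k)

/-- `b₁⁻¹ * ∑_{k ∣ b₁} φ(b₁ / k) * q ^ fixExp k`, an exact (real) quotient. -/
noncomputable def e1 (p : ℕ) (w : Datum q n) : ℝ :=
  1 / (b1 p w : ℝ) *
    ∑ k ∈ (b1 p w).divisors, (Nat.totient (b1 p w / k) : ℝ) * (q : ℝ) ^ fixExp p k w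

/-- `b₂⁻¹ * ∑ φ(b₂ / k) * q ^ fixExp k` over the `k ∣ b₂` with `ν(k) ≥ 1 + ⌊log_p t⌋`. -/
noncomputable def e2 (p : ℕ) (t : ℕ+) (w : Datum q n) : ℝ :=
  1 / (b2 p t w : ℝ) *
    ∑ k ∈ (b2 p t w).divisors with 1 + Nat.log p t ≤ padicValNat p k,
      (Nat.totient (b2 p t w / k) : ℝ) * (q : ℝ) ^ fixExp p k w

end Formula

end AGLCount

namespace AGLCount

section Burnside

/-- Group the residues `i < b` according to `gcd b i`. -/
theorem sum_range_gcd (b : ℕ) (hb : 0 < b) (g : ℕ → ℕ) :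
    ∑ i ∈ Finset.range b, g (b.gcd i) = ∑ k ∈ b.divisors, Nat.totient (b / k) * g k := by
  rw [← Finset.sum_fiberwise_of_maps_to (s := Finset.range b) (t := b.divisors)
    (g := fun i => b.gcd i)
    (fun i _ => Nat.mem_divisors.2 ⟨Nat.gcd_dvd_left b i, hb.ne'⟩)]
  refine Finset.sum_congr rfl fun k hk => ?_
  rw [Nat.totient_div_of_dvd (Nat.dvd_of_mem_divisors hk), Finset.card_eq_sum_ones,
    Finset.sum_mul]
  refine Finset.sum_congr rfl fun i hi => ?_
  rw [(Finset.mem_filter.1 hi).2, one_mul]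

theorem fix_pow_gcd {X : Type*} (σ : Equiv.Perm X) {b : ℕ} (h : σ ^ b = 1) (i : ℕ) :
    {x | (σ ^ i) x = x} = {x | (σ ^ b.gcd i) x = x} := by
  ext x
  simp only [Set.mem_ofPred_eq, ← Equiv.Perm.iterate_eq_pow]
  have hb : Function.IsPeriodicPt σ b x := by
    change σ^[b] x = x
    rw [Equiv.Perm.iterate_eq_pow, h]; rfl
  constructor
  · intro hi
    exact hb.gcd hi
  · intro hi
    exact Function.IsPeriodicPt.trans_dvd hi (Nat.gcd_dvd_right b i)

/-- The functions constant on the cycles of a permutation `σ` with `σ ^ b = 1`. -/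
theorem card_invariant_functions {X Y : Type*} [Finite X] [Finite Y] (σ : Equiv.Perm X) {b : ℕ}
    (hb : 0 < b) (h : σ ^ b = 1) :
    (Nat.card {f : X → Y // ∀ x, f (σ x) = f x} : ℝ) =
      (Nat.card Y : ℝ) ^ (1 / (b : ℝ) * ∑ k ∈ b.divisors,
        (Nat.totient (b / k) : ℝ) * (Nat.card {x // (σ ^ k) x = x} : ℝ)) := by
  classical
  have : NeZero b := ⟨hb.ne'⟩
  let φ : ZMod b →+ Additive (Equiv.Perm X) :=
    ZMod.lift b ⟨zmultiplesHom (Additive (Equiv.Perm X)) (Additive.ofMul σ), by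
      simp only [zmultiplesHom_apply, natCast_zsmul, ← ofMul_pow, h, ofMul_one]⟩
  let ψ : Multiplicative (ZMod b) →* Equiv.Perm X := AddMonoidHom.toMultiplicativeLeft φ
  have hψ : ∀ i : ℕ, ψ (Multiplicative.ofAdd (i : ZMod b)) = σ ^ i := by
    intro i
    have : φ ((i : ℤ) : ZMod b) = Additive.ofMul (σ ^ i) := by
      simp only [φ, ZMod.lift_coe, zmultiplesHom_apply, natCast_zsmul, ← ofMul_pow]
    rw [Int.cast_natCast] at this
    change Additive.toMul (φ (i : ZMod b)) = σ ^ i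
    rw [this]; rfl
  let : MulAction (Multiplicative (ZMod b)) X := MulAction.compHom X ψ
  have hsmul : ∀ (i : ℕ) (x : X), Multiplicative.ofAdd (i : ZMod b) • x = (σ ^ i) x := by
    intro i x
    change (ψ (Multiplicative.ofAdd (i : ZMod b))) x = _
    rw [hψ]
  have hrep : ∀ g : Multiplicative (ZMod b), ∃ i : ℕ, g = Multiplicative.ofAdd (i : ZMod b) := by
    intro g
    exact ⟨(Multiplicative.toAdd g).val, by simp⟩
  let Q := MulAction.orbitRel.Quotient (Multiplicative (ZMod b)) X
  have hQ : Finite Q := Quotient.finite _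
  have e : {f : X → Y // ∀ x, f (σ x) = f x} ≃ (Q → Y) :=
    { toFun := fun f => Quotient.lift f.1 (by
        rintro x y ⟨g, hg⟩
        obtain ⟨i, rfl⟩ := hrep g
        simp only [hsmul] at hg
        rw [← hg]
        clear hg
        induction i with
        | zero => rfl
        | succ i ih => rw [pow_succ', Equiv.Perm.mul_apply, f.2, ih])
      invFun := fun F => ⟨fun x => F (Quotient.mk _ x), fun x => by
        refine congrArg F (Quotient.sound ?_)
        refine ⟨Multiplicative.ofAdd ((1 : ℕ) : ZMod b), ?_⟩
        change Multiplicative.ofAdd ((1 : ℕ) : ZMod b) • x = σ x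
        rw [hsmul, pow_one]⟩
      left_inv := fun f => rfl
      right_inv := fun F => by
        funext q
        induction q using Quotient.inductionOn
        rfl }
  have := Fintype.ofFinite X
  have : Fintype Q := Fintype.ofFinite Q
  have burn := MulAction.sum_card_fixedBy_eq_card_orbits_mul_card_group
    (Multiplicative (ZMod b)) X
  have h1 : ∑ g : Multiplicative (ZMod b), Fintype.card (MulAction.fixedBy X g) =
      ∑ k ∈ b.divisors, Nat.totient (b / k) * Nat.card {x // (σ ^ k) x = x} := by
    rw [← sum_range_gcd b hb (fun k => Nat.card {x // (σ ^ k) x = x})]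
    symm
    refine Finset.sum_bij (fun i _ => Multiplicative.ofAdd (i : ZMod b)) (fun _ _ =>
      Finset.mem_univ _) ?_ ?_ ?_
    · intro i hi j hj hij
      have := Multiplicative.ofAdd.injective hij
      rw [ZMod.natCast_eq_natCast_iff'] at this
      rwa [Nat.mod_eq_of_lt (Finset.mem_range.1 hi), Nat.mod_eq_of_lt (Finset.mem_range.1 hj)]
        at this
    · intro g _
      exact ⟨(Multiplicative.toAdd g).val, Finset.mem_range.2 (ZMod.val_lt _), by simp⟩
    · intro i _
      rw [← Nat.card_eq_fintype_card]
      refine Nat.card_congr (Equiv.subtypeEquivRight fun x => ?_)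
      rw [MulAction.mem_fixedBy, hsmul]
      exact (Set.ext_iff.1 (fix_pow_gcd σ h i) x).symm
  rw [h1, Fintype.card_multiplicative, ZMod.card] at burn
  rw [Nat.card_congr e, Nat.card_fun, Nat.cast_pow, ← Real.rpow_natCast]
  congr 1
  have hb' : (b : ℝ) ≠ 0 := by exact_mod_cast hb.ne'
  have burn' := congrArg (Nat.cast (R := ℝ)) burn
  simp only [Nat.cast_sum, Nat.cast_mul] at burn'
  rw [burn', Nat.card_eq_fintype_card]
  field_simp
  congr!

end Burnside

section AffineGroup

open Matrix

variable {n : ℕ} {F : Type*} [Field F]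

/-- The affine permutation `x ↦ T x + a`. -/
def affPerm {V : Type*} [AddCommGroup V] [Module F V] (T : V ≃ₗ[F] V) (a : V) : Equiv.Perm V :=
  T.toEquiv.trans (Equiv.addRight a)

@[simp] theorem affPerm_apply {V : Type*} [AddCommGroup V] [Module F V] (T : V ≃ₗ[F] V)
    (a x : V) : affPerm T a x = T x + a := rfl

/-- The linear automorphism `x ↦ x A` attached to `A`. -/
noncomputable def glEquiv (n : ℕ) (F : Type*) [Field F] :
    GL (Fin n) F ≃ ((Fin n → F) ≃ₗ[F] (Fin n → F)) :=
  { toFun := fun A => LinearEquiv.ofLinearMap (Matrix.vecMulLinear A.1)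
      (Matrix.vecMulLinear A⁻¹.1)
      (by ext1 x; ext1; simp only [LinearMap.comp_apply, Matrix.vecMulLinear_apply,
            Matrix.vecMul_vecMul, ← Units.val_mul]; simp)
      (by ext1 x; ext1; simp only [LinearMap.comp_apply, Matrix.vecMulLinear_apply,
            Matrix.vecMul_vecMul, ← Units.val_mul]; simp)
    invFun := fun T => ⟨LinearMap.toMatrixRight' T.toLinearMap,
      LinearMap.toMatrixRight' T.symm.toLinearMap,
      by rw [← LinearMap.toMatrixRight'_comp]; simp, by rw [← LinearMap.toMatrixRight'_comp]; simp⟩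
    left_inv := fun A => by
      ext1
      exact LinearMap.toMatrixRight'.apply_symm_apply A.1
    right_inv := fun T => by
      ext1 x
      exact LinearMap.congr_fun (LinearMap.toMatrixRight'.symm_apply_apply T.toLinearMap) x }

/-- The affine linear group as a set of pairs. -/
noncomputable def aglEquiv (n : ℕ) (F : Type*) [Field F] :
    GL (Fin n) F × (Fin n → F) ≃ AGL n F :=
  Equiv.ofBijective (fun z => ⟨⟨fromBlocks z.1.1 0 (replicateRow Unit z.2) 1,
      fromBlocks z.1⁻¹.1 0 (-(replicateRow Unit z.2 * z.1⁻¹.1)) 1,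
      by rw [fromBlocks_multiply]; simp,
      by rw [fromBlocks_multiply]; simp [Matrix.mul_assoc]⟩, z.1, z.2, rfl⟩) (by
    constructor
    · rintro ⟨A, a⟩ ⟨B, b⟩ h
      have h' := congrArg (fun g : AGL n F => (g : GL (Fin n ⊕ Unit) F).val) h
      obtain ⟨h1, -, h2, -⟩ := fromBlocks_inj.1 h'
      refine Prod.ext (Units.ext h1) ?_
      funext i
      exact congrFun (congrFun h2 ()) i
    · rintro ⟨g, A, a, h⟩
      exact ⟨(A, a), Subtype.ext (Units.ext h.symm)⟩)

/-- Burnside's lemma for the action of the affine group on functions. -/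
theorem numOrbits_mul_card [Finite F] :
    numOrbits n F * (Nat.card ((Fin n → F) ≃ₗ[F] (Fin n → F)) * Nat.card F ^ n) =
      ∑ᶠ T : (Fin n → F) ≃ₗ[F] (Fin n → F), ∑ᶠ a : Fin n → F,
        Nat.card {f : (Fin n → F) → F // ∀ x, f (affPerm T a x) = f x} := by
  classical
  have := Fintype.ofFinite F
  have : Finite (GL (Fin n) F) := inferInstance
  have := Fintype.ofFinite (GL (Fin n) F)
  have : Finite ((Fin n → F) ≃ₗ[F] (Fin n → F)) := Finite.of_equiv _ (glEquiv n F)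
  have := Fintype.ofFinite ((Fin n → F) ≃ₗ[F] (Fin n → F))
  have : Finite (AGL n F) := Finite.of_equiv _ (aglEquiv n F)
  have := Fintype.ofFinite (AGL n F)
  have : Fintype (MulAction.orbitRel.Quotient (AGL n F) ((Fin n → F) → F)) := Fintype.ofFinite _
  have burn := MulAction.sum_card_fixedBy_eq_card_orbits_mul_card_group
    (AGL n F) ((Fin n → F) → F)
  rw [finsum_eq_sum_of_fintype]
  simp only [finsum_eq_sum_of_fintype]
  rw [← Fintype.sum_prod_type', numOrbits, Nat.card_eq_fintype_card]
  have hc : Nat.card ((Fin n → F) ≃ₗ[F] (Fin n → F)) * Nat.card F ^ n =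
      Fintype.card (AGL n F) := by
    rw [← Nat.card_eq_fintype_card, ← Nat.card_congr (aglEquiv n F), Nat.card_prod,
      Nat.card_congr (glEquiv n F), Nat.card_fun, Nat.card_fin]
  rw [hc]
  refine burn.symm.trans ?_
  symm
  refine Fintype.sum_equiv (((glEquiv n F).symm.prodCongr (Equiv.refl _)).trans (aglEquiv n F))
    _ _ ?_
  rintro ⟨T, a⟩
  obtain ⟨A, rfl⟩ := (glEquiv n F).surjective T
  rw [← Nat.card_eq_fintype_card]
  refine Nat.card_congr (Equiv.subtypeEquivRight fun f => ?_)
  rw [MulAction.mem_fixedBy, funext_iff]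
  simp only [Equiv.trans_apply, Equiv.prodCongr_apply, Prod.map_apply, Equiv.symm_apply_apply,
    Equiv.refl_apply]
  exact Iff.rfl

end AffineGroup

section Torsion

open Polynomial

/-- The number of elements of `M` killed by `g`. -/
noncomputable def torCard {R : Type*} [CommRing R] (M : Type*) [AddCommGroup M] [Module R M]
    (g : R) : ℕ :=
  Nat.card {x : M // g • x = 0}

theorem torCard_congr {R M M' : Type*} [CommRing R] [AddCommGroup M] [Module R M]
    [AddCommGroup M'] [Module R M'] (e : M ≃ₗ[R] M') (g : R) : torCard M g = torCard M' g :=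
  Nat.card_congr (e.toEquiv.subtypeEquiv fun x => by
    simp only [LinearEquiv.coe_toEquiv, ← map_smul, EmbeddingLike.map_eq_zero_iff])

theorem torCard_pi {R ι : Type*} [CommRing R] [Fintype ι] (M : ι → Type*)
    [∀ i, AddCommGroup (M i)] [∀ i, Module R (M i)] (g : R) :
    torCard (∀ i, M i) g = ∏ i, torCard (M i) g := by
  rw [torCard]
  unfold torCard
  rw [← Nat.card_pi]
  refine Nat.card_congr ((Equiv.subtypeEquivRight fun x => ?_).trans
    (Equiv.subtypePiEquivPi (p := fun {i} (x : M i) => g • x = 0)))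
  exact funext_iff

theorem torCard_prod {R M M' : Type*} [CommRing R] [AddCommGroup M] [Module R M]
    [AddCommGroup M'] [Module R M'] (g : R) :
    torCard (M × M') g = torCard M g * torCard M' g := by
  rw [torCard, torCard, torCard, ← Nat.card_prod]
  refine Nat.card_congr ((Equiv.subtypeEquivRight fun x => ?_).trans
    (Equiv.subtypeProdEquivProd (p := fun x : M => g • x = 0) (q := fun x : M' => g • x = 0)))
  simp [Prod.ext_iff]

variable {F : Type*} [Field F]

/-- The cyclic module `F[X] / (h)`. -/
abbrev Cyc (h : F[X]) : Type _ := F[X] ⧸ Ideal.span {h}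

theorem Cyc.mk_eq_zero {h r : F[X]} : (Submodule.Quotient.mk r : Cyc h) = 0 ↔ h ∣ r := by
  rw [Submodule.Quotient.mk_eq_zero, Ideal.mem_span_singleton]

theorem finite_cyc [Finite F] {h : F[X]} (hh : h ≠ 0) : Finite (Cyc h) := by
  have : Module.Finite F (Cyc h) := (AdjoinRoot.powerBasis hh).finite
  exact Module.finite_of_finite F

theorem card_cyc [Finite F] {h : F[X]} (hh : h ≠ 0) :
    Nat.card (Cyc h) = Nat.card F ^ h.natDegree := by
  have : Module.Finite F (Cyc h) := (AdjoinRoot.powerBasis hh).finite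
  rw [Module.natCard_eq_pow_finrank (K := F), finrank_quotient_span_eq_natDegree]

/-- The `g`-torsion of `F[X] / (f ^ e)`, where `s` is the exponent of `f` in `g`. -/
theorem torCard_cyc [Finite F] {f g : F[X]} (hf : Irreducible f) (e s : ℕ) (hs : f ^ s ∣ g)
    (hs' : ¬ f ^ (s + 1) ∣ g) :
    torCard (Cyc (f ^ e)) g = (Nat.card F ^ f.natDegree) ^ min s e := by
  let m := min s e
  let φ : F[X] →ₗ[F[X]] Cyc (f ^ e) :=
    (Submodule.mkQ (Ideal.span {f ^ e})).comp (LinearMap.lsmul F[X] F[X] (f ^ (e - m)))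
  have hφ : ∀ r, φ r = Submodule.Quotient.mk (f ^ (e - m) * r) := fun r => rfl
  have hm : f ^ e = f ^ (e - m) * f ^ m := by
    rw [← pow_add, Nat.sub_add_cancel (min_le_right s e)]
  have hne : ∀ k, f ^ k ≠ 0 := fun k => pow_ne_zero k hf.ne_zero
  have hker : LinearMap.ker φ = Ideal.span {f ^ m} := by
    ext r
    rw [LinearMap.mem_ker, hφ, Cyc.mk_eq_zero, Ideal.mem_span_singleton, hm,
      mul_dvd_mul_iff_left (hne _)]
  obtain ⟨u, rfl⟩ := hs
  have hu : IsCoprime f u := by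
    rw [hf.coprime_iff_not_dvd]
    rintro ⟨v, rfl⟩
    exact hs' ⟨v, by ring⟩
  have hrange : ∀ x, x ∈ LinearMap.range φ ↔ (f ^ s * u) • x = 0 := by
    intro x
    obtain ⟨r, rfl⟩ := Submodule.Quotient.mk_surjective _ x
    rw [← Submodule.Quotient.mk_smul, Cyc.mk_eq_zero, smul_eq_mul]
    have h1 : Submodule.Quotient.mk r ∈ LinearMap.range φ ↔ f ^ (e - m) ∣ r := by
      constructor
      · rintro ⟨t, ht⟩
        rw [hφ, ← sub_eq_zero, ← Submodule.Quotient.mk_sub, Cyc.mk_eq_zero] at ht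
        have h2 := (pow_dvd_pow f (Nat.sub_le e m)).trans ht
        exact (dvd_sub_right (dvd_mul_right _ _)).1 h2
      · rintro ⟨t, rfl⟩
        exact ⟨t, rfl⟩
    rw [h1]
    rcases le_total s e with hse | hse
    · have hms : m = s := min_eq_left hse
      have : f ^ e = f ^ s * f ^ (e - s) := by rw [← pow_add, Nat.add_sub_cancel' hse]
      rw [this, mul_assoc, mul_dvd_mul_iff_left (hne _), hms]
      exact ⟨fun h => h.mul_left u, fun h => (IsCoprime.pow_left hu).dvd_of_dvd_mul_left h⟩
    · have hms : m = e := min_eq_right hse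
      rw [hms, Nat.sub_self, pow_zero, mul_assoc]
      exact ⟨fun _ => (pow_dvd_pow f hse).mul_right _, fun _ => one_dvd _⟩
  have : torCard (Cyc (f ^ e)) (f ^ s * u) = Nat.card (LinearMap.range φ) :=
    Nat.card_congr (Equiv.subtypeEquivRight fun x => (hrange x).symm)
  rw [this, ← Nat.card_congr φ.quotKerEquivRange.toEquiv, hker, card_cyc (hne _), natDegree_pow,
    ← pow_mul, mul_comm]

end Torsion

section InjectiveMaps

open Polynomial

variable {F : Type*} [Field F]

/-- The number of injective linear maps. -/
noncomputable def injCard (R M' M : Type*) [CommRing R] [AddCommGroup M'] [Module R M']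
    [AddCommGroup M] [Module R M] : ℕ :=
  Nat.card {φ : M' →ₗ[R] M // Function.Injective φ}

theorem injCard_congr {R M' M'' M : Type*} [CommRing R] [AddCommGroup M'] [Module R M']
    [AddCommGroup M''] [Module R M''] [AddCommGroup M] [Module R M] (e : M' ≃ₗ[R] M'') :
    injCard R M' M = injCard R M'' M :=
  Nat.card_congr ((LinearEquiv.congrLeft M R e).toEquiv.subtypeEquiv fun φ =>
    (Function.Injective.of_comp_iff' φ e.symm.bijective).symm)

theorem exists_eq_pow_mul_and_not_dvd_of_irreducible {f r : F[X]} (hf : Irreducible f)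
    (hr : r ≠ 0) : ∃ (s : ℕ) (u : F[X]), ¬ f ∣ u ∧ r = f ^ s * u := by
  obtain ⟨u, hu, hu'⟩ :=
    (FiniteMultiplicity.of_not_isUnit hf.not_isUnit hr).exists_eq_pow_mul_and_not_dvd
  exact ⟨_, u, hu', hu⟩

/-- Linear maps from a cyclic module are the torsion elements. -/
noncomputable def cycHom (M : Type*) [AddCommGroup M] [Module F[X] M] (h : F[X]) :
    {x : M // h • x = 0} ≃ (Cyc h →ₗ[F[X]] M) where
  toFun x := Submodule.liftQ _ (LinearMap.toSpanSingleton F[X] M x.1) (by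
    rw [Ideal.span, Submodule.span_le]
    rintro _ rfl
    simpa using x.2)
  invFun ψ := ⟨ψ (Submodule.Quotient.mk 1), by
    rw [← map_smul, ← Submodule.Quotient.mk_smul, Cyc.mk_eq_zero.2 (by simp), map_zero]⟩
  left_inv x := by
    ext
    exact one_smul F[X] x.1
  right_inv ψ := by
    refine LinearMap.ext fun c => ?_
    obtain ⟨r, rfl⟩ := Submodule.Quotient.mk_surjective _ c
    change r • ψ (Submodule.Quotient.mk 1) = ψ (Submodule.Quotient.mk r)
    rw [← map_smul, ← Submodule.Quotient.mk_smul, smul_eq_mul, mul_one]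

theorem cycHom_mk (M : Type*) [AddCommGroup M] [Module F[X] M] (h : F[X])
    (x : {x : M // h • x = 0}) (r : F[X]) : cycHom M h x (Submodule.Quotient.mk r) = r • x.1 :=
  rfl

theorem coprod_cycHom_injective_iff {M M' : Type*} [AddCommGroup M] [Module F[X] M]
    [AddCommGroup M'] [Module F[X] M'] {f : F[X]} (hf : Irreducible f) {e : ℕ}
    (φ : M' →ₗ[F[X]] M) (x : {x : M // f ^ (e + 1) • x = 0}) :
    Function.Injective (φ.coprod (cycHom M _ x)) ↔
      Function.Injective φ ∧ ¬ ∃ y : {y : M' // f • y = 0}, f ^ e • x.1 = φ y := by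
  have hne : ∀ k, f ^ k ≠ 0 := fun k => pow_ne_zero k hf.ne_zero
  constructor
  · intro h
    refine ⟨fun y z hyz => ?_, ?_⟩
    · have := @h (y, 0) (z, 0) (by simpa using hyz)
      exact (Prod.ext_iff.1 this).1
    · rintro ⟨y, hy⟩
      have := @h (y.1, 0) (0, Submodule.Quotient.mk (f ^ e)) (by
        rw [LinearMap.coprod_apply, LinearMap.coprod_apply, cycHom_mk, hy, map_zero, map_zero,
          add_zero, zero_add])
      have h2 := (Prod.ext_iff.1 this).2.symm
      rw [Cyc.mk_eq_zero, pow_dvd_pow_iff hf.ne_zero hf.not_isUnit] at h2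
      omega
  · rintro ⟨h1, h2⟩
    rw [injective_iff_map_eq_zero]
    rintro ⟨y, c⟩ h
    obtain ⟨r, rfl⟩ := Submodule.Quotient.mk_surjective _ c
    rw [LinearMap.coprod_apply, cycHom_mk] at h
    by_cases hr : f ^ (e + 1) ∣ r
    · have hc := Cyc.mk_eq_zero.2 hr
      obtain ⟨v, rfl⟩ := hr
      rw [mul_comm, mul_smul, x.2, smul_zero, add_zero] at h
      rw [Prod.mk_eq_zero]
      exact ⟨h1 (by rw [h, map_zero]), hc⟩
    · exfalso
      apply h2
      have hr0 : r ≠ 0 := fun h => hr (h ▸ dvd_zero _)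
      obtain ⟨s, u, hu, rfl⟩ := exists_eq_pow_mul_and_not_dvd_of_irreducible hf hr0
      have hs : s ≤ e := by
        by_contra hs
        exact hr (Dvd.dvd.mul_right (pow_dvd_pow f (by omega)) u)
      obtain ⟨b, a, hab⟩ := (hf.coprime_iff_not_dvd).2 hu
      have hx : f ^ e • x.1 = φ (-(a * f ^ (e - s)) • y) := by
        have h3 : φ y = -((f ^ s * u) • x.1) := eq_neg_of_add_eq_zero_left h
        rw [map_smul, h3, smul_neg, neg_smul, neg_neg, smul_smul]
        have : a * f ^ (e - s) * (f ^ s * u) = f ^ e + (- b) * f ^ (e + 1) := by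
          have : f ^ e = f ^ (e - s) * f ^ s := by rw [← pow_add, Nat.sub_add_cancel hs]
          rw [pow_succ, this]
          linear_combination (f ^ (e - s) * f ^ s) * hab
        rw [this, add_smul, mul_smul, x.2, smul_zero, add_zero]
      refine ⟨⟨-(a * f ^ (e - s)) • y, h1 ?_⟩, hx⟩
      rw [map_smul, ← hx, smul_smul, ← pow_succ', x.2, map_zero]

/-- Pairs whose components satisfy `p` and a relation. -/
def _root_.Equiv.subtypeProdSigma {α β : Type*} (p : α → Prop) (r : α → β → Prop) :
    {z : α × β // p z.1 ∧ r z.1 z.2} ≃ Σ a : {a // p a}, {b // r a.1 b} where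
  toFun z := ⟨⟨z.1.1, z.2.1⟩, ⟨z.1.2, z.2.2⟩⟩
  invFun z := ⟨(z.1.1, z.2.1), z.1.2, z.2.2⟩
  left_inv _ := rfl
  right_inv _ := rfl

/-- Extending an injective map by a cyclic summand. -/
theorem injCard_prod_cyc [Finite F] {M M' : Type*} [AddCommGroup M] [Module F[X] M] [Finite M]
    [AddCommGroup M'] [Module F[X] M'] [Finite M'] {f : F[X]} (hf : Irreducible f) {e : ℕ}
    (hM' : ∀ y : M', f • y = 0 → ∃ z : M', f ^ e • z = y) :
    injCard F[X] (M' × Cyc (f ^ (e + 1))) M = injCard F[X] M' M *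
      (torCard M (f ^ (e + 1)) - torCard M' f * torCard M (f ^ e)) := by
  classical
  have := finite_cyc (pow_ne_zero (e + 1) hf.ne_zero)
  have : Finite (M' →ₗ[F[X]] M) := DFunLike.finite _
  have := Fintype.ofFinite {φ : M' →ₗ[F[X]] M // Function.Injective φ}
  let e₁ : (M' × Cyc (f ^ (e + 1)) →ₗ[F[X]] M) ≃
      (M' →ₗ[F[X]] M) × {x : M // f ^ (e + 1) • x = 0} :=
    (LinearMap.coprodEquiv F[X]).toEquiv.symm.trans
      ((Equiv.refl _).prodCongr (cycHom M _).symm)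
  let r : (M' →ₗ[F[X]] M) → {x : M // f ^ (e + 1) • x = 0} → Prop := fun φ x =>
    ¬ ∃ y : {y : M' // f • y = 0}, f ^ e • x.1 = φ y
  have E := (e₁.subtypeEquiv
    (p := fun φ : M' × Cyc (f ^ (e + 1)) →ₗ[F[X]] M => Function.Injective φ)
    (q := fun z : (M' →ₗ[F[X]] M) × {x : M // f ^ (e + 1) • x = 0} =>
      Function.Injective z.1 ∧ r z.1 z.2) (fun φ => by
      have h := coprod_cycHom_injective_iff hf (φ.comp (LinearMap.inl _ _ _))
        ((cycHom M _).symm (φ.comp (LinearMap.inr _ _ _)))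
      rw [Equiv.apply_symm_apply, LinearMap.coprod_comp_inl_inr] at h
      exact h)).trans (Equiv.subtypeProdSigma (fun φ : M' →ₗ[F[X]] M => Function.Injective φ) r)
  rw [injCard, Nat.card_congr E, Nat.card_sigma, Finset.sum_const_nat (m :=
    torCard M (f ^ (e + 1)) - torCard M' f * torCard M (f ^ e))]
  · rw [Finset.card_univ, ← Nat.card_eq_fintype_card, injCard]
  · rintro ⟨φ, hφ⟩ -
    have h1 : Nat.card {x : {x : M // f ^ (e + 1) • x = 0} //
        ∃ y : {y : M' // f • y = 0}, f ^ e • x.1 = φ y} = torCard M' f * torCard M (f ^ e) := by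
      choose z hz using hM'
      rw [torCard, torCard, ← Nat.card_prod]
      let Φ : {y : M' // f • y = 0} × {x : M // f ^ e • x = 0} →
          {x : {x : M // f ^ (e + 1) • x = 0} //
            ∃ y : {y : M' // f • y = 0}, f ^ e • x.1 = φ y} := fun w =>
        ⟨⟨w.2.1 + φ (z w.1.1 w.1.2), by
          rw [smul_add, pow_succ', mul_smul, w.2.2, mul_smul, ← map_smul, hz, ← map_smul, w.1.2]
          simp⟩, w.1, by
          simp only [smul_add]
          rw [w.2.2, ← map_smul, hz, zero_add]⟩
      refine (Nat.card_congr (Equiv.ofBijective Φ ⟨?_, ?_⟩)).symm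
      · rintro ⟨⟨y, hy⟩, ⟨x, hx⟩⟩ ⟨⟨y', hy'⟩, ⟨x', hx'⟩⟩ h
        simp only [Φ, Subtype.mk.injEq] at h
        have h2 := congrArg (fun v => f ^ e • v) h
        simp only [smul_add, ← map_smul, hz, hx, hx', zero_add] at h2
        obtain rfl := hφ h2
        simpa using h
      · rintro ⟨⟨x, hx⟩, ⟨y, hy⟩⟩
        refine ⟨⟨y, ⟨x - φ (z y.1 y.2), ?_⟩⟩, ?_⟩
        · rw [smul_sub, ← map_smul, hz, sub_eq_zero]
          exact hy
        · simp [Φ]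
    have := Fintype.ofFinite {x : M // f ^ (e + 1) • x = 0}
    rw [← h1, torCard, Nat.card_eq_fintype_card, Nat.card_eq_fintype_card,
      Nat.card_eq_fintype_card, Fintype.card_subtype_compl]

end InjectiveMaps

section Blocks

open Polynomial

variable {F : Type*} [Field F]

theorem exists_pow_smul_eq_of_cyc {f g : F[X]} (hf : Irreducible f) (hg : Irreducible g)
    (hfg : f ∣ g → f = g) {e m : ℕ} (hem : e < m) (c : Cyc (g ^ m)) (hc : f • c = 0) :
    ∃ z : Cyc (g ^ m), f ^ e • z = c := by
  obtain ⟨r, rfl⟩ := Submodule.Quotient.mk_surjective _ c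
  rw [← Submodule.Quotient.mk_smul, Cyc.mk_eq_zero, smul_eq_mul] at hc
  by_cases h : f ∣ g
  · obtain rfl := hfg h
    obtain ⟨m, rfl⟩ := Nat.exists_eq_add_of_lt hem
    rw [pow_succ', mul_dvd_mul_iff_left hf.ne_zero] at hc
    obtain ⟨v, rfl⟩ := hc
    exact ⟨Submodule.Quotient.mk (f ^ m * v), by
      rw [← Submodule.Quotient.mk_smul, smul_eq_mul, ← mul_assoc, ← pow_add]⟩
  · have hco : IsCoprime (g ^ m) f := (IsCoprime.pow_right (hf.coprime_iff_not_dvd.2 h)).symm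
    exact ⟨0, by rw [smul_zero]; exact (Cyc.mk_eq_zero.2 (hco.dvd_of_dvd_mul_left hc)).symm⟩

/-- Splitting off one factor of a finite product. -/
noncomputable def piInsertEquiv (R : Type*) [CommRing R] {K : Type*} [DecidableEq K]
    (A : K → Type*)
    [∀ k, AddCommGroup (A k)] [∀ k, Module R (A k)] {s : Finset K} {a : K} (ha : a ∉ s) :
    (∀ k : (insert a s : Finset K), A k.1) ≃ₗ[R] (∀ k : s, A k.1) × A a :=
  LinearEquiv.ofBijective
    ((LinearMap.pi fun k : s => LinearMap.proj
        (⟨k.1, Finset.mem_insert_of_mem k.2⟩ : (insert a s : Finset K))).prod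
      (LinearMap.proj (⟨a, Finset.mem_insert_self a s⟩ : (insert a s : Finset K)))) (by
    constructor
    · intro x y h
      have h1 := congrArg Prod.fst h
      have h2 := congrArg Prod.snd h
      funext ⟨k, hk⟩
      rcases Finset.mem_insert.1 hk with rfl | hk'
      · exact h2
      · exact congrFun h1 ⟨k, hk'⟩
    · rintro ⟨x, y⟩
      refine ⟨fun k => if h : k.1 = a then cast (congrArg A h.symm) y else
        x ⟨k.1, (Finset.mem_insert.1 k.2).resolve_left h⟩, Prod.ext ?_ ?_⟩
      · funext k
        have : k.1 ≠ a := fun h => ha (h ▸ k.2)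
        change (if h : k.1 = a then cast (congrArg A h.symm) y else x ⟨k.1, _⟩) = x k
        rw [dif_neg this]
      · change (if h : a = a then cast (congrArg A h.symm) y else x ⟨a, _⟩) = y
        rw [dif_pos rfl, cast_eq])

/-- Extending an injective map by a power of a cyclic module. -/
theorem injCard_prod_cyc_pow [Finite F] {M M' : Type*} [AddCommGroup M] [Module F[X] M] [Finite M]
    [AddCommGroup M'] [Module F[X] M'] [Finite M'] {f : F[X]} (hf : Irreducible f) {e : ℕ}
    (hM' : ∀ y : M', f • y = 0 → ∃ z : M', f ^ e • z = y) (m : ℕ) :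
    injCard F[X] (M' × (Fin m → Cyc (f ^ (e + 1)))) M = injCard F[X] M' M *
      ∏ u ∈ Finset.range m, (torCard M (f ^ (e + 1)) -
        torCard M' f * (Nat.card F ^ f.natDegree) ^ u * torCard M (f ^ e)) := by
  have := finite_cyc (pow_ne_zero (e + 1) hf.ne_zero)
  induction m with
  | zero =>
    rw [Finset.range_zero, Finset.prod_empty, mul_one]
    exact injCard_congr (LinearEquiv.prodUnique)
  | succ m ih =>
    have E : (M' × (Fin (m + 1) → Cyc (f ^ (e + 1)))) ≃ₗ[F[X]]
        (M' × (Fin m → Cyc (f ^ (e + 1)))) × Cyc (f ^ (e + 1)) :=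
      ((LinearEquiv.refl _ M').prodCongr ((Fin.consLinearEquiv F[X]
        (fun _ : Fin (m + 1) => Cyc (f ^ (e + 1)))).symm.trans (LinearEquiv.prodComm _ _ _))).trans
        (LinearEquiv.prodAssoc _ _ _ _).symm
    rw [injCard_congr E, injCard_prod_cyc hf, ih, Finset.prod_range_succ, mul_assoc, torCard_prod,
      torCard_pi, Finset.prod_const, Finset.card_univ, Fintype.card_fin,
      torCard_cyc hf (e + 1) 1 (by simp) (by
        rw [← pow_one f, ← pow_mul, pow_dvd_pow_iff hf.ne_zero hf.not_isUnit]; simp),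
      Nat.min_eq_left (by omega), pow_one]
    rintro ⟨y, x⟩ hyx
    rw [Prod.smul_mk, Prod.mk_eq_zero] at hyx
    obtain ⟨z, hz⟩ := hM' y hyx.1
    choose w hw using fun i => exists_pow_smul_eq_of_cyc hf hf (fun _ => rfl) (Nat.lt_succ_self e)
      (x i) (congrFun hyx.2 i)
    exact ⟨(z, w), Prod.ext hz (funext hw)⟩

variable {J : Type*}

/-- The direct sum of `μ (j, e)` copies of `F[X] / (P j ^ e)`, over `(j, e) ∈ s`. -/
abbrev Blk (P : J → F[X]) (μ : J × ℕ+ → ℕ) (s : Finset (J × ℕ+)) : Type _ :=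
  ∀ k : s, (Fin (μ k.1) → Cyc (P k.1.1 ^ (k.1.2 : ℕ)))

variable {P : J → F[X]} (hP : ∀ j, Irreducible (P j)) (μ : J × ℕ+ → ℕ)

theorem finite_blk [Finite F] (hP : ∀ j, Irreducible (P j)) (s : Finset (J × ℕ+)) :
    Finite (Blk P μ s) := by
  have := fun k : s => finite_cyc (pow_ne_zero (k.1.2 : ℕ) (hP k.1.1).ne_zero)
  infer_instance

theorem torCard_blk [Finite F] (hP : ∀ j, Irreducible (P j)) (s : Finset (J × ℕ+)) (g : F[X])
    (σ : J → ℕ) (h : ∀ j, P j ^ σ j ∣ g ∧ ¬ P j ^ (σ j + 1) ∣ g) :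
    torCard (Blk P μ s) g =
      ∏ k ∈ s, (Nat.card F ^ (P k.1).natDegree) ^ (min (σ k.1) k.2 * μ k) := by
  rw [torCard_pi, ← Finset.prod_coe_sort s]
  refine Finset.prod_congr rfl fun k _ => ?_
  rw [torCard_pi, Finset.prod_const, Finset.card_univ, Fintype.card_fin,
    torCard_cyc (hP k.1.1) _ _ (h _).1 (h _).2, ← pow_mul]

theorem torCard_blk_pow [Finite F] [DecidableEq J] (hP : ∀ j, Irreducible (P j))
    (hPP : ∀ i j, P i ∣ P j → i = j) (s : Finset (J × ℕ+)) (j : J) (c : ℕ) :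
    torCard (Blk P μ s) (P j ^ c) =
      (Nat.card F ^ (P j).natDegree) ^ ∑ k ∈ s with k.1 = j, min c k.2 * μ k := by
  rw [torCard_blk μ hP s _ (fun i => if i = j then c else 0), ← Finset.prod_pow_eq_pow_sum,
    Finset.prod_filter]
  · refine Finset.prod_congr rfl fun k _ => ?_
    split_ifs with h
    · rw [h]
    · simp
  · intro i
    split_ifs with h
    · subst h
      refine ⟨dvd_rfl, ?_⟩
      rw [pow_dvd_pow_iff (hP i).ne_zero (hP i).not_isUnit]
      omega
    · refine ⟨by simp, ?_⟩
      rw [zero_add, pow_one]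
      exact fun hd => h (hPP _ _ ((hP i).prime.dvd_of_dvd_pow hd))

theorem injCard_blk [Finite F] [DecidableEq J] (hP : ∀ j, Irreducible (P j))
    (hPP : ∀ i j, P i ∣ P j → i = j) {M : Type*} [AddCommGroup M] [Module F[X] M] [Finite M]
    (s : Finset (J × ℕ+)) :
    injCard F[X] (Blk P μ s) M = ∏ k ∈ s, ∏ u ∈ Finset.range (μ k),
      (torCard M (P k.1 ^ (k.2 : ℕ)) - (Nat.card F ^ (P k.1).natDegree) ^
        ((∑ k' ∈ s with k'.1 = k.1 ∧ k.2 < k'.2, μ k') + u) *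
          torCard M (P k.1 ^ ((k.2 : ℕ) - 1))) := by
  induction s using Finset.induction_on_min_value (fun k : J × ℕ+ => k.2) with
  | empty =>
    rw [Finset.prod_empty, injCard, Nat.card_eq_one_iff_unique]
    exact ⟨⟨fun a b => Subtype.ext (LinearMap.ext fun x => by
      rw [Subsingleton.elim x 0, map_zero, map_zero])⟩,
      ⟨⟨0, fun x y _ => Subsingleton.elim x y⟩⟩⟩
  | insert a s ha hs ih =>
    obtain ⟨e, he⟩ : ∃ e, (a.2 : ℕ) = e + 1 := ⟨a.2 - 1, by have := a.2.pos; omega⟩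
    have := finite_blk μ hP s
    rw [injCard_congr (piInsertEquiv F[X]
      (fun k => Fin (μ k) → Cyc (P k.1 ^ (k.2 : ℕ))) ha), Finset.prod_insert ha, mul_comm]
    have key := injCard_prod_cyc_pow (M := M) (M' := Blk P μ s) (hP a.1) (e := e) (by
      intro y hy
      choose z hz using fun (k : s) (i : Fin (μ k)) => exists_pow_smul_eq_of_cyc (hP a.1) (hP k.1.1)
        (fun h => by rw [hPP _ _ h]) (e := e) (m := k.1.2) (by
          have := PNat.coe_le_coe _ _ |>.2 (hs k.1 k.2); omega) (y k i) (congrFun (congrFun hy k) i)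
      exact ⟨z, funext fun k => funext fun i => hz k i⟩) (μ a)
    rw [← he] at key
    rw [key, ih]
    congr 1
    · refine Finset.prod_congr rfl fun k hk => ?_
      rw [Finset.filter_insert, if_neg]
      exact fun h => (hs k hk).not_gt h.2
    · refine Finset.prod_congr rfl fun u _ => ?_
      have h1 := torCard_blk_pow μ hP hPP s a.1 1
      rw [pow_one] at h1
      rw [h1, ← pow_add, he, Nat.add_sub_cancel, Finset.filter_insert, if_neg (by simp)]
      have h2 : s.filter (fun k => k.1 = a.1) = s.filter (fun k => k.1 = a.1 ∧ a.2 < k.2) := by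
        refine Finset.filter_congr fun k hk => ?_
        refine ⟨fun h => ⟨h, lt_of_le_of_ne (hs k hk) fun h2 => ha ?_⟩, fun h => h.1⟩
        rwa [show a = k from Prod.ext h.symm h2]
      have h3 : ∀ k : J × ℕ+, min 1 (k.2 : ℕ) * μ k = μ k := fun k => by
        rw [Nat.min_eq_left (show 1 ≤ (k.2 : ℕ) from k.2.pos), one_mul]
      rw [h2, Finset.sum_congr rfl fun k _ => h3 k]

end Blocks

section PartitionSums

/-- The number of parts larger than `m`, with multiplicity. -/
def Ptn.lenAbove (m : ℕ) (lam : Ptn) : ℕ := ∑ j ∈ lam.support with m < PNat.val j, lam j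

theorem Ptn.minSum_succ (m : ℕ) (lam : Ptn) :
    lam.minSum (m + 1) = lam.minSum m + lam.lenAbove m := by
  rw [Ptn.minSum, Ptn.minSum, Ptn.lenAbove, Finset.sum_filter, ← Finset.sum_add_distrib]
  refine Finset.sum_congr rfl fun j _ => ?_
  split_ifs with h
  · rw [Nat.min_eq_left (show m + 1 ≤ (j : ℕ) from h), Nat.min_eq_left h.le, add_one_mul]
  · rw [Nat.min_eq_right (by omega), Nat.min_eq_right (by omega), add_zero]

theorem Ptn.lenAbove_pred (e : ℕ+) (lam : Ptn) :
    lam.lenAbove (e - 1) = lam e + lam.lenAbove e := by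
  have h1 : lam.lenAbove (e - 1) = ∑ j ∈ insert e lam.support with (e : ℕ) - 1 < PNat.val j, lam j := by
    rw [Ptn.lenAbove]
    refine Finset.sum_subset (Finset.filter_subset_filter _ (Finset.subset_insert _ _)) ?_
    intro x hx hx'
    simp only [Finset.mem_filter, Finsupp.mem_support_iff, not_and'] at hx hx'
    simpa using hx' hx.2
  have h2 : lam.lenAbove e = ∑ j ∈ insert e lam.support with (e : ℕ) < PNat.val j, lam j := by
    rw [Ptn.lenAbove]
    refine Finset.sum_subset (Finset.filter_subset_filter _ (Finset.subset_insert _ _)) ?_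
    intro x hx hx'
    simp only [Finset.mem_filter, Finsupp.mem_support_iff, not_and'] at hx hx'
    simpa using hx' hx.2
  have h3 : (insert e lam.support).filter (fun j : ℕ+ => (e : ℕ) - 1 < (j : ℕ)) =
      insert e ((insert e lam.support).filter (fun j : ℕ+ => (e : ℕ) < (j : ℕ))) := by
    ext j
    have he := e.pos
    simp only [Finset.mem_filter, Finset.mem_insert, ← PNat.coe_inj]
    constructor
    · rintro ⟨h1, h2⟩
      by_cases h : (j : ℕ) = e
      · exact Or.inl h
      · exact Or.inr ⟨h1, by omega⟩
    · rintro (h | ⟨h1, h2⟩)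
      · exact ⟨Or.inl h, by omega⟩
      · exact ⟨h1, by omega⟩
  rw [h1, h2, h3, Finset.sum_insert (by simp)]

theorem Ptn.quad_eq (lam : Ptn) : lam.quad = ∑ e ∈ lam.support, lam.minSum e * lam e := by
  rw [Ptn.quad]
  refine Finset.sum_congr rfl fun e _ => ?_
  rw [Ptn.minSum, Finset.sum_mul]
  exact Finset.sum_congr rfl fun k _ => by ring

theorem Ptn.minSum_injective {lam eta : Ptn} (h : ∀ m, lam.minSum m = eta.minSum m) :
    lam = eta := by
  have h1 : ∀ m, lam.lenAbove m = eta.lenAbove m := fun m => by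
    have := h (m + 1)
    rw [Ptn.minSum_succ, Ptn.minSum_succ, h m] at this
    omega
  ext e
  have h2 := lam.lenAbove_pred e
  rw [h1, h1, Ptn.lenAbove_pred] at h2
  omega

theorem Ptn.minSum_of_top_le {lam : Ptn} {m : ℕ} (h : lam.top ≤ m) : lam.minSum m = lam.size := by
  refine Finset.sum_congr rfl fun j hj => ?_
  rw [Nat.min_eq_right]
  exact (Finset.le_sup (f := fun i : ℕ+ => (i : ℕ)) hj).trans h

end PartitionSums

section PrimaryModule

open Polynomial

variable {F : Type*} [Field F] {J : Type*} [Fintype J]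

open Classical in
/-- The pairs `(j, e)` such that `e` is a part of `lam j`. -/
noncomputable def parts (lam : J → Ptn) : Finset (J × ℕ+) :=
  (Finset.univ ×ˢ Finset.univ.biUnion fun j => (lam j).support).filter fun k => lam k.1 k.2 ≠ 0

theorem mem_parts {lam : J → Ptn} (k : J × ℕ+) :
    k ∈ parts lam ↔ k.1 ∈ Finset.univ ∧ k.2 ∈ (lam k.1).support := by
  simp only [parts, Finset.mem_filter, Finset.mem_product, Finset.mem_univ, true_and,
    Finset.mem_biUnion, Finsupp.mem_support_iff, and_iff_right_iff_imp]
  exact fun h => ⟨_, h⟩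

@[to_additive]
theorem prod_parts {A : Type*} [CommMonoid A] (lam : J → Ptn) (g : J × ℕ+ → A) :
    ∏ k ∈ parts lam, g k = ∏ j, ∏ e ∈ (lam j).support, g (j, e) :=
  Finset.prod_finset_product _ _ _ mem_parts

theorem sum_parts_filter [DecidableEq J] (lam : J → Ptn) (j : J) (p : ℕ+ → Prop)
    [DecidablePred p] (g : J × ℕ+ → ℕ) :
    ∑ k ∈ parts lam with k.1 = j ∧ p k.2, g k = ∑ e ∈ (lam j).support with p e, g (j, e) := by
  rw [Finset.sum_filter, sum_parts, Finset.sum_eq_single j]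
  · simp [Finset.sum_filter]
  · intro i _ hij
    simp [hij]
  · simp

/-- `⨁_j ⨁_e (F[X] / (P j ^ e)) ^ (lam j e)`. -/
abbrev PMod (P : J → F[X]) (lam : J → Ptn) : Type _ := Blk P (fun k => lam k.1 k.2) (parts lam)

variable [Finite F] {P : J → F[X]} (hP : ∀ j, Irreducible (P j))

include hP

theorem finite_pmod (lam : J → Ptn) : Finite (PMod P lam) := finite_blk _ hP _

theorem card_pmod (lam : J → Ptn) :
    Nat.card (PMod P lam) = ∏ j, (Nat.card F ^ (P j).natDegree) ^ (lam j).size := by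
  rw [Nat.card_pi, Finset.prod_coe_sort (parts lam)
    (fun k => Nat.card (Fin (lam k.1 k.2) → Cyc (P k.1 ^ (k.2 : ℕ)))), prod_parts]
  refine Finset.prod_congr rfl fun j _ => ?_
  rw [Ptn.size, Finsupp.sum, ← Finset.prod_pow_eq_pow_sum]
  refine Finset.prod_congr rfl fun e _ => ?_
  rw [Nat.card_fun, card_cyc (pow_ne_zero _ (hP j).ne_zero), Nat.card_fin, natDegree_pow,
    ← pow_mul, ← pow_mul]
  congr 1
  ring

theorem torCard_pmod (lam : J → Ptn) (g : F[X]) (σ : J → ℕ)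
    (h : ∀ j, P j ^ σ j ∣ g ∧ ¬ P j ^ (σ j + 1) ∣ g) :
    torCard (PMod P lam) g = ∏ j, (Nat.card F ^ (P j).natDegree) ^ (lam j).minSum (σ j) := by
  rw [torCard_blk _ hP _ g σ h, prod_parts]
  refine Finset.prod_congr rfl fun j _ => ?_
  rw [Ptn.minSum, ← Finset.prod_pow_eq_pow_sum]

variable (hPP : ∀ i j, P i ∣ P j → i = j)

include hPP

theorem torCard_pmod_pow (lam : J → Ptn) (j : J) (c : ℕ) :
    torCard (PMod P lam) (P j ^ c) = (Nat.card F ^ (P j).natDegree) ^ (lam j).minSum c := by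
  classical
  have := sum_parts_filter lam j (fun _ => True) (fun k => min c k.2 * lam k.1 k.2)
  simp only [and_true, Finset.filter_true] at this
  rw [torCard_blk_pow _ hP hPP, this, Ptn.minSum]

theorem card_aut_pmod (lam : J → Ptn) :
    (Nat.card (PMod P lam ≃ₗ[F[X]] PMod P lam) : ℝ) = ∏ j,
      (((Nat.card F : ℝ) ^ (P j).natDegree) ^ (lam j).quad *
        ∏ e ∈ (lam j).support, ∏ u ∈ Finset.Icc 1 (lam j e),
          (1 - (((Nat.card F : ℝ) ^ (P j).natDegree) ^ u)⁻¹)) := by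
  classical
  have := finite_pmod hP lam
  have h1 : Nat.card (PMod P lam ≃ₗ[F[X]] PMod P lam) =
      injCard F[X] (PMod P lam) (PMod P lam) := by
    refine Nat.card_congr (Equiv.ofBijective (fun φ => ⟨φ.toLinearMap, φ.injective⟩) ⟨?_, ?_⟩)
    · intro φ ψ h
      exact LinearEquiv.toLinearMap_injective (congrArg Subtype.val h)
    · rintro ⟨φ, hφ⟩
      exact ⟨LinearEquiv.ofBijective φ ⟨hφ, Finite.surjective_of_injective hφ⟩,
        Subtype.ext (LinearMap.ext fun x => rfl)⟩
  rw [h1, injCard_blk _ hP hPP, prod_parts, Nat.cast_prod]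
  refine Finset.prod_congr rfl fun j _ => ?_
  rw [Ptn.quad_eq, ← Finset.prod_pow_eq_pow_sum, ← Finset.prod_mul_distrib, Nat.cast_prod]
  refine Finset.prod_congr rfl fun e he => ?_
  have hsum := sum_parts_filter lam j (fun e' => e < e') (fun k => lam k.1 k.2)
  have habove : ∑ e' ∈ (lam j).support with e < e', lam j e' = (lam j).lenAbove e := rfl
  simp only [hsum, habove, torCard_pmod_pow hP hPP]
  have hrec : (lam j).minSum e = (lam j).minSum (e - 1) + (lam j e + (lam j).lenAbove e) := by
    rw [← Ptn.lenAbove_pred, ← Ptn.minSum_succ, Nat.sub_add_cancel e.pos]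
  have hrefl : ∏ u ∈ Finset.Icc 1 (lam j e), (1 - (((Nat.card F : ℝ) ^ (P j).natDegree) ^ u)⁻¹) =
      ∏ u ∈ Finset.range (lam j e),
        (1 - (((Nat.card F : ℝ) ^ (P j).natDegree) ^ (lam j e - u))⁻¹) := by
    refine Finset.prod_nbij' (fun u => lam j e - u) (fun u => lam j e - u) ?_ ?_ ?_ ?_ ?_
    · intro u hu; rw [Finset.mem_Icc] at hu; rw [Finset.mem_range]; omega
    · intro u hu; rw [Finset.mem_range] at hu; rw [Finset.mem_Icc]; omega
    · intro u hu; rw [Finset.mem_Icc] at hu; omega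
    · intro u hu; rw [Finset.mem_range] at hu; omega
    · intro u hu; rw [Finset.mem_Icc] at hu; rw [show lam j e - (lam j e - u) = u by omega]
  rw [hrefl, pow_mul, Nat.cast_prod]
  have hpow : ∀ x : ℝ, x ^ lam j e = ∏ _u ∈ Finset.range (lam j e), x := fun x => by simp
  rw [hpow, ← Finset.prod_mul_distrib]
  refine Finset.prod_congr rfl fun u hu => ?_
  rw [Finset.mem_range] at hu
  have hq : 0 < Nat.card F ^ (P j).natDegree := pow_pos Nat.card_pos _
  have hq' : ((Nat.card F : ℝ) ^ (P j).natDegree) ≠ 0 := by exact_mod_cast hq.ne'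
  rw [Nat.cast_sub]
  · push_cast
    rw [mul_sub, mul_one, ← pow_add, ← div_eq_mul_inv, eq_comm, sub_right_inj, eq_comm,
      eq_div_iff (pow_ne_zero _ hq'), ← pow_add, hrec]
    congr 1
    omega
  · rw [← pow_add]
    exact Nat.pow_le_pow_right hq (by omega)

end PrimaryModule

section Classification

open Polynomial

variable {F : Type*} [Field F]

/-- Cyclic modules of associated polynomials. -/
noncomputable def cycCongr {f g : F[X]} (h : Associated f g) : Cyc f ≃ₗ[F[X]] Cyc g :=
  Submodule.quotEquivOfEq _ _ (Ideal.span_singleton_eq_span_singleton.2 h)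

theorem exists_ptn_family {I J : Type*} [Finite I] (g : I → J × ℕ+) :
    ∃ lam : J → Ptn, ∀ k : J × ℕ+, Nonempty (Fin (lam k.1 k.2) ≃ {i // g i = k}) := by
  refine ⟨fun j => Finsupp.ofSupportFinite (fun e => Nat.card {i // g i = (j, e)}) ?_, ?_⟩
  · refine (Set.finite_range fun i => (g i).2).subset fun e he => ?_
    rw [Function.mem_support] at he
    obtain ⟨⟨i, hi⟩⟩ := (Nat.card_ne_zero.1 he).1
    exact ⟨i, by simp [hi]⟩
  · rintro ⟨j, e⟩
    exact ⟨(Finite.equivFin _).symm⟩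

variable {J : Type*} [Fintype J]

/-- A product of cyclic primary modules, sorted by prime and exponent. -/
theorem exists_pmod_equiv {P : J → F[X]} {ι : Type*} [Finite ι] (p : ι → F[X]) (e : ι → ℕ)
    (h : ∀ i, 0 < e i → ∃ j, Associated (p i) (P j)) :
    ∃ lam : J → Ptn, Nonempty ((∀ i, Cyc (p i ^ e i)) ≃ₗ[F[X]] PMod P lam) := by
  classical
  let I := {i // 0 < e i}
  choose j hj using fun i : I => h i.1 i.2
  let g : I → J × ℕ+ := fun i => (j i, ⟨e i, i.2⟩)
  obtain ⟨lam, hlam⟩ := exists_ptn_family g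
  have hmem : ∀ i, g i ∈ parts lam := fun i => by
    rw [mem_parts, Finsupp.mem_support_iff]
    obtain ⟨ε⟩ := hlam (g i)
    exact ⟨Finset.mem_univ _, (Fin.pos (ε.symm ⟨i, rfl⟩)).ne'⟩
  have hass : ∀ (k : parts lam) (z : {i // g i = k.1}),
      Associated (p z.1.1 ^ e z.1.1) (P k.1.1 ^ (k.1.2 : ℕ)) := by
    intro ⟨k, hk⟩ ⟨i, hz⟩
    have hz' : g i = k := hz
    subst hz'
    exact (hj i).pow_pow
  let Φ : (∀ i, Cyc (p i ^ e i)) →ₗ[F[X]]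
      (∀ k : parts lam, ({i // g i = k.1} → Cyc (P k.1.1 ^ (k.1.2 : ℕ)))) :=
    LinearMap.pi fun k => LinearMap.pi fun z =>
      (cycCongr (hass k z)).toLinearMap.comp (LinearMap.proj z.1.1)
  have hΦ : ∀ x k z, Φ x k z = cycCongr (hass k z) (x z.1.1) := fun _ _ _ => rfl
  have hbij : Function.Bijective Φ := by
    constructor
    · rw [injective_iff_map_eq_zero]
      intro x hx
      funext i
      by_cases hi : 0 < e i
      · have h1 := congrFun (congrFun hx ⟨g ⟨i, hi⟩, hmem _⟩) ⟨⟨i, hi⟩, rfl⟩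
        rw [hΦ] at h1
        exact (LinearEquiv.map_eq_zero_iff _).1 h1
      · obtain ⟨r, hr⟩ := Submodule.Quotient.mk_surjective _ (x i)
        rw [← hr]
        exact Cyc.mk_eq_zero.2 (by rw [Nat.eq_zero_of_not_pos hi, pow_zero]; exact one_dvd r)
    · intro y
      refine ⟨fun i => if hi : 0 < e i then (cycCongr (hass ⟨g ⟨i, hi⟩, hmem _⟩ ⟨⟨i, hi⟩, rfl⟩)).symm
        (y ⟨g ⟨i, hi⟩, hmem _⟩ ⟨⟨i, hi⟩, rfl⟩) else 0, ?_⟩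
      funext ⟨k, hk⟩ ⟨⟨i, hi⟩, hz⟩
      have hz' : g ⟨i, hi⟩ = k := hz
      subst hz'
      rw [hΦ]
      simp only [dif_pos hi]
      exact LinearEquiv.apply_symm_apply _ _
  exact ⟨lam, ⟨(LinearEquiv.ofBijective Φ hbij).trans (LinearEquiv.piCongrRight fun k =>
    LinearEquiv.funCongrLeft F[X] _ (hlam k.1).some)⟩⟩

theorem finite_aeval {V : Type*} [AddCommGroup V] [Module F V] [Finite V] (T : Module.End F V) :
    Finite (Module.AEval' T) :=
  Finite.of_equiv V (Module.AEval'.of T).toEquiv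

theorem torCard_aeval {V : Type*} [AddCommGroup V] [Module F V] (T : Module.End F V) (g : F[X]) :
    torCard (Module.AEval' T) g = Nat.card (LinearMap.ker (aeval T g)) :=
  (Nat.card_congr ((Module.AEval'.of T).toEquiv.subtypeEquiv fun x => by
    rw [LinearMap.mem_ker]
    exact Iff.rfl)).symm

theorem isTorsion_aeval {V : Type*} [AddCommGroup V] [Module F V] [Finite V]
    (T : Module.End F V) : Module.IsTorsion F[X] (Module.AEval' T) := by
  have : Module.Finite F V := Module.Finite.of_finite
  intro x
  refine ⟨⟨minpoly F T, mem_nonZeroDivisors_of_ne_zero (minpoly.ne_zero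
    (Algebra.IsIntegral.isIntegral T))⟩, ?_⟩
  change aeval T (minpoly F T) • (Module.AEval'.of T).symm x = 0
  rw [minpoly.aeval]
  exact zero_smul _ _

variable [Finite F] {P : J → F[X]} (hP : ∀ j, Irreducible (P j))

/-- Every automorphism of a finite vector space has a type. -/
theorem exists_aeval_equiv_pmod {V : Type*} [AddCommGroup V] [Module F V] [Finite V]
    (hall : ∀ f : F[X], Irreducible f → ¬ f ∣ X → f.natDegree ≤ Module.finrank F V →
      ∃ j, Associated f (P j)) (T : V ≃ₗ[F] V) :
    ∃ lam : J → Ptn, Nonempty (Module.AEval' (T : Module.End F V) ≃ₗ[F[X]] PMod P lam) := by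
  classical
  have := finite_aeval (T : Module.End F V)
  have : Module.Finite F V := Module.Finite.of_finite
  obtain ⟨ι, _, p, hp, e, ⟨l⟩⟩ := Module.equiv_directSum_of_isTorsion
    (isTorsion_aeval (T : Module.End F V))
  have l' : Module.AEval' (T : Module.End F V) ≃ₗ[F[X]] ∀ i, Cyc (p i ^ e i) :=
    l.trans (DirectSum.linearEquivFunOnFintype F[X] ι _)
  obtain ⟨lam, ⟨l''⟩⟩ := exists_pmod_equiv (P := P) p e fun i hi => hall (p i) (hp i) (by
    intro hX
    have h1 : torCard (Module.AEval' (T : Module.End F V)) (X : F[X]) = 1 := by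
      rw [torCard_aeval, aeval_X, LinearMap.ker_eq_bot.2 T.injective, Nat.card_unique]
    have h2 : ¬ p i ^ (1 + 1) ∣ (X : F[X]) := by
      intro h
      have := irreducible_X.squarefree (p i) (by simpa [pow_two] using h)
      exact (hp i).not_isUnit this
    rw [torCard_congr l', torCard_pi, Finset.prod_eq_one_iff] at h1
    have h3 := h1 i (Finset.mem_univ i)
    rw [torCard_cyc (hp i) (e i) 1 (by simpa using hX) h2, Nat.min_eq_left hi, pow_one,
      Nat.pow_eq_one] at h3
    have := (hp i).natDegree_pos
    have := Finite.one_lt_card (α := F)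
    omega) (by
    have h1 : Nat.card (Cyc (p i ^ e i)) ≤ Nat.card V := by
      rw [Nat.card_congr (Module.AEval'.of (T : Module.End F V)).toEquiv]
      exact Nat.card_le_card_of_surjective (fun x => l' x i)
        ((Function.surjective_eval i).comp l'.surjective)
    rw [card_cyc (pow_ne_zero _ (hp i).ne_zero), Module.natCard_eq_pow_finrank (K := F) (V := V),
      Nat.pow_le_pow_iff_right Finite.one_lt_card, natDegree_pow] at h1
    exact (Nat.le_mul_of_pos_left _ hi).trans h1)
  exact ⟨lam, ⟨l'.trans l''⟩⟩

omit [Fintype J] in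
include hP in
theorem one_lt_card_pow_natDegree (j : J) : 1 < Nat.card F ^ (P j).natDegree :=
  Nat.one_lt_pow (hP j).natDegree_pos.ne' Finite.one_lt_card

include hP

theorem pmod_equiv_unique (hPP : ∀ i j, P i ∣ P j → i = j) {lam eta : J → Ptn}
    (l : PMod P lam ≃ₗ[F[X]] PMod P eta) : lam = eta := by
  funext j
  refine Ptn.minSum_injective fun m => ?_
  have := torCard_congr l (P j ^ m)
  rw [torCard_pmod_pow hP hPP, torCard_pmod_pow hP hPP] at this
  exact Nat.pow_right_injective (one_lt_card_pow_natDegree hP j) this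

theorem sum_size_eq_finrank {V : Type*} [AddCommGroup V] [Module F V] [Finite V]
    {T : Module.End F V} {lam : J → Ptn} (l : Module.AEval' T ≃ₗ[F[X]] PMod P lam) :
    ∑ j, (P j).natDegree * (lam j).size = Module.finrank F V := by
  have : Module.Finite F V := Module.Finite.of_finite
  have h := card_pmod hP lam
  rw [← Nat.card_congr l.toEquiv, ← Nat.card_congr (Module.AEval'.of T).toEquiv,
    Module.natCard_eq_pow_finrank (K := F)] at h
  simp only [← pow_mul] at h
  rw [Finset.prod_pow_eq_pow_sum] at h
  exact (Nat.pow_right_injective Finite.one_lt_card h).symm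

/-- The automorphisms of a given type form one orbit under base change. -/
theorem card_type_mul_card_aut {V : Type*} [AddCommGroup V] [Module F V] [Finite V]
    (hX : ∀ j, ¬ P j ∣ X) {lam : J → Ptn}
    (hn : ∑ j, (P j).natDegree * (lam j).size = Module.finrank F V) :
    Nat.card {T : V ≃ₗ[F] V //
        Nonempty (Module.AEval' (T : Module.End F V) ≃ₗ[F[X]] PMod P lam)} *
      Nat.card (PMod P lam ≃ₗ[F[X]] PMod P lam) = Nat.card (V ≃ₗ[F] V) := by
  classical
  have hfin := finite_pmod hP lam
  have : Module.Finite F V := Module.Finite.of_finite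
  have : Module.Finite F (PMod P lam) := Module.Finite.of_finite
  have hrank : Module.finrank F (PMod P lam) = Module.finrank F V := by
    have h := card_pmod hP lam
    rw [Module.natCard_eq_pow_finrank (K := F)] at h
    simp only [← pow_mul] at h
    rw [Finset.prod_pow_eq_pow_sum, hn] at h
    exact Nat.pow_right_injective Finite.one_lt_card h
  have hinj : Function.Injective (fun x : PMod P lam => (X : F[X]) • x) := by
    have h1 := torCard_pmod hP lam (X : F[X]) (fun _ => 0) (fun j => by simpa using hX j)
    simp only [Ptn.minSum, Nat.zero_min, zero_mul, Finset.sum_const_zero, pow_zero,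
      Finset.prod_const_one] at h1
    obtain ⟨h2, -⟩ := Nat.card_eq_one_iff_unique.1 h1
    intro x y hxy
    have := @Subsingleton.elim _ h2 ⟨x - y, by rw [smul_sub, sub_eq_zero]; exact hxy⟩
      ⟨0, smul_zero _⟩
    exact sub_eq_zero.1 (congrArg Subtype.val this)
  let A : PMod P lam ≃ₗ[F] PMod P lam :=
    LinearEquiv.ofBijective ((LinearMap.lsmul F[X] (PMod P lam) X).restrictScalars F)
      ⟨hinj, Finite.surjective_of_injective hinj⟩
  have hA : ∀ x, A x = (X : F[X]) • x := fun _ => rfl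
  let Ty := {T : V ≃ₗ[F] V // Nonempty (Module.AEval' (T : Module.End F V) ≃ₗ[F[X]] PMod P lam)}
  let Ψ : (Σ T : Ty, PMod P lam ≃ₗ[F[X]] Module.AEval' (T.1 : Module.End F V)) →
      (PMod P lam ≃ₗ[F] V) := fun z =>
    (z.2.restrictScalars F).trans (Module.AEval'.of (z.1.1 : Module.End F V)).symm
  have hΨ : ∀ z x, Ψ z x = (Module.AEval'.of (z.1.1 : Module.End F V)).symm (z.2 x) :=
    fun _ _ => rfl
  have hΨX : ∀ z x, Ψ z (A x) = z.1.1 (Ψ z x) := by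
    intro z x
    rw [hΨ, hA, map_smul, Module.AEval'.of_symm_X_smul, hΨ]
    rfl
  have hbij : Function.Bijective Ψ := by
    constructor
    · rintro ⟨T, φ⟩ ⟨T', φ'⟩ h
      have hT : T = T' := by
        refine Subtype.ext (LinearEquiv.ext fun v => ?_)
        obtain ⟨x, rfl⟩ := (Ψ ⟨T, φ⟩).surjective v
        rw [← hΨX ⟨T, φ⟩, h, hΨX]
      subst hT
      congr 1
      exact LinearEquiv.ext fun x => (Module.AEval'.of (T.1 : Module.End F V)).symm.injective
        (LinearEquiv.congr_fun h x)
    · intro ψ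
      let T : V ≃ₗ[F] V := (ψ.symm.trans A).trans ψ
      let φ : Module.AEval' (T : Module.End F V) ≃ₗ[F[X]] PMod P lam :=
        LinearEquiv.ofAEval (T : Module.End F V) ψ.symm (fun m => by
          rw [← hA]
          exact ψ.symm_apply_apply _)
      exact ⟨⟨⟨T, ⟨φ⟩⟩, φ.symm⟩, LinearEquiv.ext fun x => rfl⟩
  have h1 : Nat.card (PMod P lam ≃ₗ[F] V) = Nat.card (V ≃ₗ[F] V) := by
    have e₀ : PMod P lam ≃ₗ[F] V := LinearEquiv.ofFinrankEq _ _ hrank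
    exact Nat.card_congr ⟨fun ψ => e₀.symm.trans ψ, fun ψ => e₀.trans ψ,
      fun ψ => by ext1; simp, fun ψ => by ext1; simp⟩
  have : Finite (V ≃ₗ[F] V) := DFunLike.finite _
  have := Fintype.ofFinite Ty
  have : ∀ T : Ty, Finite (PMod P lam ≃ₗ[F[X]] Module.AEval' (T.1 : Module.End F V)) := fun T => by
    have := finite_aeval (T.1 : Module.End F V)
    exact DFunLike.finite _
  rw [← h1, ← Nat.card_congr (Equiv.ofBijective Ψ hbij), Nat.card_sigma,
    Finset.sum_const_nat (m := Nat.card (PMod P lam ≃ₗ[F[X]] PMod P lam))]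
  · rw [Finset.card_univ, Nat.card_eq_fintype_card]
  · rintro ⟨T, ⟨φ⟩⟩ -
    exact Nat.card_congr ⟨fun ψ => ψ.trans φ, fun ψ => ψ.trans φ.symm,
      fun ψ => by ext1; simp, fun ψ => by ext1; simp⟩

end Classification

section AffineFixedPoints

open Polynomial

variable {F : Type*} [Field F] {V : Type*} [AddCommGroup V] [Module F V]

/-- `im (T - 1) + ker ((T - 1) ^ t)`. -/
def transSpace (T : Module.End F V) (t : ℕ) : Submodule F V :=
  LinearMap.range (T - 1) ⊔ LinearMap.ker ((T - 1) ^ t)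

theorem transSpace_mono (T : Module.End F V) : Monotone (transSpace T) := by
  intro s t h
  refine sup_le_sup_left (fun x hx => ?_) _
  rw [LinearMap.mem_ker] at hx ⊢
  rw [← Nat.sub_add_cancel h, pow_add, Module.End.mul_apply, hx, map_zero]

theorem card_transSpace_mul [Finite V] (T : Module.End F V) (t : ℕ) :
    Nat.card (transSpace T t) * Nat.card (LinearMap.ker ((T - 1) ^ (t + 1))) =
      Nat.card V * Nat.card (LinearMap.ker ((T - 1) ^ t)) := by
  let φ : V × LinearMap.ker ((T - 1) ^ t) →ₗ[F] V :=
    (T - 1).coprod (LinearMap.ker ((T - 1) ^ t)).subtype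
  have hr : LinearMap.range φ = transSpace T t := by
    rw [LinearMap.range_coprod, Submodule.range_subtype, transSpace]
  have hk : Nat.card (LinearMap.ker φ) = Nat.card (LinearMap.ker ((T - 1) ^ (t + 1))) := by
    refine Nat.card_congr (Equiv.ofBijective (fun z => ⟨z.1.1, ?_⟩) ⟨?_, ?_⟩)
    · obtain ⟨⟨v, ⟨c, hc⟩⟩, hz⟩ := z
      have h1 : (T - 1) v + c = 0 := hz
      rw [LinearMap.mem_ker, pow_succ, Module.End.mul_apply, eq_neg_of_add_eq_zero_left h1,
        map_neg, LinearMap.mem_ker.1 hc, neg_zero]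
    · rintro ⟨⟨v, ⟨c, hc⟩⟩, hz⟩ ⟨⟨v', ⟨c', hc'⟩⟩, hz'⟩ h
      have h1 : (T - 1) v + c = 0 := hz
      have h2 : (T - 1) v' + c' = 0 := hz'
      obtain rfl : v = v' := congrArg Subtype.val h
      obtain rfl : c = c' := by rw [eq_neg_of_add_eq_zero_right h1, eq_neg_of_add_eq_zero_right h2]
      rfl
    · rintro ⟨v, hv⟩
      refine ⟨⟨⟨v, ⟨-(T - 1) v, ?_⟩⟩, ?_⟩, rfl⟩
      · rw [LinearMap.mem_ker, pow_succ, Module.End.mul_apply] at hv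
        rw [LinearMap.mem_ker, map_neg, hv, neg_zero]
      · change (T - 1) v + -(T - 1) v = 0
        rw [add_neg_cancel]
  rw [← Nat.card_prod (α := V), ← hr, ← hk, ← Nat.card_congr φ.quotKerEquivRange.toEquiv,
    Submodule.card_eq_card_quotient_mul_card (LinearMap.ker φ), mul_comm]

theorem affPerm_pow_apply (T : V ≃ₗ[F] V) (a x : V) (k : ℕ) :
    (affPerm T a ^ k) x = ((T : Module.End F V) ^ k) x +
      (∑ i ∈ Finset.range k, (T : Module.End F V) ^ i) a := by
  induction k with
  | zero => simp
  | succ k ih =>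
    rw [pow_succ', Equiv.Perm.mul_apply, ih, affPerm_apply, Finset.sum_range_succ', pow_succ',
      Module.End.mul_apply, map_add, pow_zero, LinearMap.add_apply, Module.End.one_apply]
    simp only [pow_succ', ← Finset.mul_sum, Module.End.mul_apply]
    exact add_assoc _ _ _

theorem exists_factor_X_pow_sub_one (p : ℕ) [CharP F p] [hp : Fact p.Prime] {k : ℕ}
    (hk : k ≠ 0) : ∃ H : F[X], IsCoprime (X - 1) H ∧
      X ^ k - 1 = (X - 1) ^ p ^ padicValNat p k * H ∧
      ∑ i ∈ Finset.range k, (X : F[X]) ^ i = (X - 1) ^ (p ^ padicValNat p k - 1) * H := by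
  have : ExpChar F p := ExpChar.prime hp.out
  have : CharP F[X] p := inferInstance
  have : ExpChar F[X] p := ExpChar.prime hp.out
  obtain ⟨m, hm⟩ : p ^ padicValNat p k ∣ k := pow_padicValNat_dvd
  have hpm : ¬ p ∣ m := by
    rintro ⟨m', rfl⟩
    refine pow_succ_padicValNat_not_dvd (p := p) hk ⟨m', ?_⟩
    rw [pow_succ, mul_assoc, ← hm]
  set s := p ^ padicValNat p k with hs
  have hs0 : 0 < s := pow_pos hp.out.pos _
  have hX1 : (X - 1 : F[X]) ≠ 0 := by
    have := X_sub_C_ne_zero (1 : F)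
    rwa [C_1] at this
  let h : F[X] := ∑ i ∈ Finset.range m, X ^ i
  have hh : h * (X - 1) = X ^ m - 1 := geom_sum_mul X m
  have hfac : (X : F[X]) ^ k - 1 = (X - 1) ^ s * h ^ s := by
    rw [hm, mul_comm s m, pow_mul, hs]
    have : ((X : F[X]) ^ m - 1) ^ p ^ padicValNat p k = (X ^ m) ^ p ^ padicValNat p k - 1 := by
      rw [sub_pow_expChar_pow, one_pow]
    rw [← this, ← hh, mul_pow, mul_comm]
  refine ⟨h ^ s, ?_, hfac, ?_⟩
  · refine IsCoprime.pow_right ?_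
    have hirr : Irreducible (X - 1 : F[X]) := by
      have := irreducible_X_sub_C (1 : F)
      rwa [C_1] at this
    rw [hirr.coprime_iff_not_dvd, ← C_1, dvd_iff_isRoot, IsRoot.def]
    simp only [h, eval_finsetSum, eval_pow, eval_X, one_pow, Finset.sum_const, Finset.card_range,
      nsmul_eq_mul, mul_one]
    rwa [CharP.cast_eq_zero_iff F p]
  · apply mul_right_cancel₀ hX1
    rw [geom_sum_mul, hfac, mul_right_comm, ← pow_succ, Nat.sub_add_cancel hs0]

variable (p : ℕ) [CharP F p] [hp : Fact p.Prime]

include hp in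
theorem exists_fixed_point_iff (T : V ≃ₗ[F] V) (a : V) {k : ℕ} (hk : k ≠ 0) :
    (∃ x, (affPerm T a ^ k) x = x) ↔
      a ∈ transSpace (T : Module.End F V) (p ^ padicValNat p k - 1) := by
  obtain ⟨H, hco, h1, h2⟩ := exists_factor_X_pow_sub_one (F := F) p hk
  set s := p ^ padicValNat p k with hs
  have hs0 : 0 < s := pow_pos hp.out.pos _
  set S : Module.End F V := (T : Module.End F V) with hS
  have e1 : S ^ k - 1 = aeval S H * (S - 1) ^ s := by
    have := congrArg (aeval S) h1
    rw [mul_comm] at this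
    simpa using this
  have e2 : ∑ i ∈ Finset.range k, S ^ i = aeval S H * (S - 1) ^ (s - 1) := by
    have := congrArg (aeval S) h2
    rw [mul_comm] at this
    simpa using this
  have hfix : ∀ x, (affPerm T a ^ k) x = x ↔
      aeval S H (((S - 1) ^ (s - 1)) (a + (S - 1) x)) = 0 := by
    intro x
    have e3 : (S ^ k) x = x + (S ^ k - 1) x := by simp
    rw [affPerm_pow_apply, ← hS, e3, e2, e1, add_assoc, add_eq_left, map_add, map_add, add_comm]
    have : (S - 1) ^ s = (S - 1) ^ (s - 1) * (S - 1) := by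
      rw [← pow_succ, Nat.sub_add_cancel hs0]
    rw [this]
    rfl
  simp only [hfix]
  rw [transSpace, Submodule.mem_sup]
  constructor
  · rintro ⟨x, hx⟩
    obtain ⟨u, v, huv⟩ := hco
    have h3 := congrArg (fun g => aeval S g (a + (S - 1) x)) huv
    simp only [map_add, map_mul, map_one, map_sub, aeval_X, LinearMap.add_apply,
      Module.End.mul_apply, Module.End.one_apply] at h3
    have hcomm : ∀ g : F[X], aeval S g * (S - 1) = (S - 1) * aeval S g := by
      intro g
      have : S - 1 = aeval S (X - 1 : F[X]) := by simp
      rw [this, ← map_mul, ← map_mul, mul_comm]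
    refine ⟨(S - 1) (aeval S u (a + (S - 1) x) - x), ⟨_, rfl⟩,
      aeval S v (aeval S H (a + (S - 1) x)), ?_, ?_⟩
    · rw [LinearMap.mem_ker]
      have hc2 : ∀ g : F[X], (S - 1) ^ (s - 1) * aeval S g = aeval S g * (S - 1) ^ (s - 1) :=
        fun g => ((show Commute (aeval S g) (S - 1) from hcomm g).pow_right _).eq.symm
      rw [← Module.End.mul_apply, hc2, Module.End.mul_apply, ← Module.End.mul_apply _ (aeval S H),
        hc2, Module.End.mul_apply, hx, map_zero]
    · rw [map_sub, ← Module.End.mul_apply, ← hcomm, Module.End.mul_apply]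
      rw [sub_add_eq_add_sub, sub_eq_iff_eq_add]
      simp only [map_add] at h3 ⊢
      rw [← h3]
      abel
  · rintro ⟨_, ⟨y, rfl⟩, c, hc, rfl⟩
    refine ⟨-y, ?_⟩
    rw [map_neg, add_neg_eq_iff_eq_add.2 (add_comm _ _), LinearMap.mem_ker.1 hc, map_zero]

include hp in
theorem card_fixed_points [Finite V] (T : V ≃ₗ[F] V) (a : V) {k : ℕ} (hk : k ≠ 0)
    [Decidable (a ∈ transSpace (T : Module.End F V) (p ^ padicValNat p k - 1))] :
    Nat.card {x // (affPerm T a ^ k) x = x} =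
      if a ∈ transSpace (T : Module.End F V) (p ^ padicValNat p k - 1) then
        Nat.card (LinearMap.ker ((T : Module.End F V) ^ k - 1)) else 0 := by
  split_ifs with h
  · obtain ⟨x₀, hx₀⟩ := (exists_fixed_point_iff p T a hk).2 h
    refine Nat.card_congr ((Equiv.subRight x₀).subtypeEquiv fun x => ?_)
    rw [affPerm_pow_apply] at hx₀ ⊢
    rw [LinearMap.mem_ker, Equiv.subRight_apply, LinearMap.sub_apply, map_sub, sub_eq_zero,
      Module.End.one_apply]
    generalize ((T : Module.End F V) ^ k) x = y, ((T : Module.End F V) ^ k) x₀ = y₀,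
      (∑ i ∈ Finset.range k, (T : Module.End F V) ^ i) a = c at *
    constructor
    · rintro rfl
      rw [← hx₀]
      abel
    · intro h
      calc y + c = (y - y₀) + (y₀ + c) := by abel
        _ = x := by rw [h, hx₀, sub_add_cancel]
  · rw [← exists_fixed_point_iff p T a hk, not_exists] at h
    have : IsEmpty {x // (affPerm T a ^ k) x = x} := ⟨fun x => h x.1 x.2⟩
    exact Nat.card_of_isEmpty

include hp in
theorem affPerm_pow_eq_one (T : V ≃ₗ[F] V) (a : V) {b : ℕ} (hb : b ≠ 0)
    (hT : (T : Module.End F V) ^ b = 1)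
    (ha : a ∈ transSpace (T : Module.End F V) (p ^ padicValNat p b - 1)) :
    affPerm T a ^ b = 1 := by
  obtain ⟨x₀, hx₀⟩ := (exists_fixed_point_iff p T a hb).2 ha
  rw [affPerm_pow_apply, hT, Module.End.one_apply, add_eq_left] at hx₀
  ext x
  rw [affPerm_pow_apply, hT, hx₀, add_zero]
  rfl

end AffineFixedPoints

section Filtration

variable {F : Type*} [Field F] {V : Type*} [AddCommGroup V] [Module F V] [Finite V]

theorem Ptn.lenAbove_zero (lam : Ptn) : lam.lenAbove 0 = lam.len := by
  rw [Ptn.lenAbove, Finset.filter_true_of_mem fun j _ => j.pos]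
  rfl

theorem Ptn.lenAbove_pred_eq_lenFrom (t : ℕ+) (lam : Ptn) :
    lam.lenAbove (t - 1) = lam.lenFrom t := by
  rw [Ptn.lenAbove, Ptn.lenFrom]
  congr 1
  refine Finset.filter_congr fun j _ => ?_
  rw [← PNat.coe_le_coe]
  have := t.pos
  have := j.pos
  change (t : ℕ) - 1 < (j : ℕ) ↔ _
  omega

theorem Ptn.lenAbove_of_top_le {m : ℕ} {lam : Ptn} (h : lam.top ≤ m) : lam.lenAbove m = 0 := by
  refine Finset.sum_eq_zero fun j hj => ?_
  rw [Finset.mem_filter] at hj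
  have : (j : ℕ) ≤ lam.top := Finset.le_sup (f := fun i : ℕ+ => (i : ℕ)) hj.1
  exact absurd (this.trans h) (not_le.2 hj.2)

/-- Summation along an increasing filtration whose jumps are the parts of a partition. -/
theorem sum_filtration [Fintype V] {q : ℕ} (hq : 0 < q) (U : ℕ → Submodule F V) (hU : Monotone U)
    (lam : Ptn) (hc : ∀ t, Nat.card (U t) * q ^ lam.lenAbove t = Nat.card V) (f : V → ℝ) (E₀ : ℝ)
    (E : ℕ+ → ℝ) (h₀ : ∀ a ∈ U 0, f a = E₀)
    (h : ∀ (t : ℕ+) (a : V), t ∈ lam.support → a ∈ U t → a ∉ U (t - 1) → f a = E t) :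
    ∑ a, f a = (Nat.card V : ℝ) * (((q : ℝ) ^ lam.len)⁻¹ * E₀ +
      ∑ t ∈ lam.support, ((q : ℝ) ^ lam t - 1) / (q : ℝ) ^ lam.lenFrom t * E t) := by
  classical
  have hq' : (q : ℝ) ≠ 0 := by exact_mod_cast hq.ne'
  have hcard : ∀ t, (Nat.card (U t) : ℝ) = Nat.card V / (q : ℝ) ^ lam.lenAbove t := fun t => by
    rw [eq_div_iff (pow_ne_zero _ hq')]
    exact_mod_cast hc t
  have htop : U lam.top = ⊤ := by
    have := hc lam.top
    rw [Ptn.lenAbove_of_top_le le_rfl, pow_zero, mul_one] at this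
    by_contra hne
    have h3 : (U lam.top : Set V) = Set.univ :=
      Set.eq_of_subset_of_ncard_le (Set.subset_univ _) (by
        rw [Set.ncard_univ, ← this]; exact le_rfl) (Set.toFinite _)
    exact hne (SetLike.coe_injective h3)
  have hex : ∀ a, ∃ t, a ∈ U t := fun a => ⟨lam.top, htop ▸ Submodule.mem_top⟩
  let lev : V → ℕ+ := fun a => (Nat.find (hex a)).toPNat'
  have hlev : ∀ (a : V) (t : ℕ+), a ∉ U 0 → (lev a = t ↔ a ∈ U t ∧ a ∉ U (t - 1)) := by
    intro a t ha
    have h0 : 0 < Nat.find (hex a) := by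
      rw [Nat.find_pos]; exact ha
    have h1 : lev a = t ↔ Nat.find (hex a) = t := by
      rw [← PNat.coe_inj]
      simp only [lev, Nat.toPNat'_coe, h0, if_true]
    rw [h1, Nat.find_eq_iff]
    refine and_congr_right fun _ => ⟨fun h => h _ (by have := t.pos; omega), fun h r hr har => ?_⟩
    exact h (hU (by omega) har)
  have hmaps : ∀ a ∈ Finset.univ.filter (fun a => a ∉ U 0), lev a ∈ lam.support := by
    intro a ha
    rw [Finset.mem_filter] at ha
    obtain ⟨h1, h2⟩ := (hlev a _ ha.2).1 rfl
    rw [Finsupp.mem_support_iff]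
    intro h3
    have h4 := (lam.lenAbove_pred (lev a))
    rw [h3, zero_add] at h4
    have h5 : Nat.card (U (lev a - 1)) = Nat.card (U (lev a)) := by
      have := (hc (lev a - 1)).trans (hc (lev a)).symm
      rw [h4] at this
      exact Nat.eq_of_mul_eq_mul_right (pow_pos hq _) this
    have h6 : (U (lev a - 1) : Set V) = U (lev a) :=
      Set.eq_of_subset_of_ncard_le (hU (Nat.sub_le _ _)) (by
        exact h5.symm.le) (Set.toFinite _)
    exact h2 (by rw [← SetLike.mem_coe, h6]; exact h1)
  rw [← Finset.sum_filter_add_sum_filter_not Finset.univ (fun a => a ∈ U 0), mul_add,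
    Finset.mul_sum]
  congr 1
  · rw [Finset.sum_congr rfl (fun a ha => h₀ a (Finset.mem_filter.1 ha).2), Finset.sum_const,
      nsmul_eq_mul, ← mul_assoc, ← div_eq_mul_inv, ← Ptn.lenAbove_zero, ← hcard,
      Nat.card_eq_fintype_card, Fintype.card_subtype]
  · rw [← Finset.sum_fiberwise_of_maps_to hmaps]
    refine Finset.sum_congr rfl fun t ht => ?_
    have hset : (Finset.univ.filter fun a => a ∉ U 0).filter (fun a => lev a = t) =
        (Finset.univ.filter fun a => a ∈ U t) \ Finset.univ.filter fun a => a ∈ U (t - 1) := by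
      ext a
      simp only [Finset.mem_filter, Finset.mem_univ, true_and, Finset.mem_sdiff]
      constructor
      · rintro ⟨h1, h2⟩
        exact (hlev a t h1).1 h2
      · intro h1
        have h2 : a ∉ U 0 := fun h2 => h1.2 (hU (Nat.zero_le _) h2)
        exact ⟨h2, (hlev a t h2).2 h1⟩
    have hf : ∀ a ∈ (Finset.univ.filter fun a => a ∈ U t) \
        Finset.univ.filter (fun a => a ∈ U (t - 1)), f a = E t := by
      intro a ha
      simp only [Finset.mem_sdiff, Finset.mem_filter, Finset.mem_univ, true_and] at ha
      exact h t a ht ha.1 ha.2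
    rw [hset, Finset.sum_congr rfl hf, Finset.sum_const, nsmul_eq_mul, ← mul_assoc]
    congr 1
    have hsub : (Finset.univ.filter fun a => a ∈ U (t - 1)) ⊆
        Finset.univ.filter fun a => a ∈ U t := by
      intro a
      simp only [Finset.mem_filter, Finset.mem_univ, true_and]
      exact fun h => hU (Nat.sub_le _ _) h
    rw [Finset.cast_card_sdiff hsub, ← Fintype.card_subtype, ← Fintype.card_subtype,
      ← Nat.card_eq_fintype_card, ← Nat.card_eq_fintype_card]
    change (Nat.card (U t) : ℝ) - (Nat.card (U (t - 1)) : ℝ) = _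
    rw [hcard, hcard, Ptn.lenAbove_pred_eq_lenFrom, ← Ptn.lenAbove_pred_eq_lenFrom,
      Ptn.lenAbove_pred, pow_add]
    field_simp

end Filtration

section IrreducibleFactors

open Polynomial

variable {F : Type*} [Field F]

theorem dvd_iff_aeval_root {f : F[X]} (g : F[X]) : f ∣ g ↔ aeval (AdjoinRoot.root f) g = 0 := by
  rw [AdjoinRoot.aeval_eq, AdjoinRoot.mk_eq_zero]

theorem isPrimitiveRoot_root {f : F[X]} (hf : Irreducible f) {d : ℕ} (hd : (d : F) ≠ 0)
    (h : f ∣ cyclotomic d F) : IsPrimitiveRoot (AdjoinRoot.root f) d := by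
  have : Fact (Irreducible f) := ⟨hf⟩
  have : NeZero (d : AdjoinRoot f) := ⟨by
    rw [← map_natCast (algebraMap F (AdjoinRoot f))]
    exact (_root_.map_ne_zero _).2 hd⟩
  rw [← isRoot_cyclotomic_iff, IsRoot.def, ← map_cyclotomic d (algebraMap F (AdjoinRoot f)),
    eval_map_algebraMap]
  exact (dvd_iff_aeval_root _).1 h

theorem dvd_X_pow_sub_one_iff {f : F[X]} (hf : Irreducible f) {d : ℕ} (hd : (d : F) ≠ 0)
    (h : f ∣ cyclotomic d F) (k : ℕ) : f ∣ X ^ k - 1 ↔ d ∣ k := by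
  rw [dvd_iff_aeval_root, map_sub, map_pow, aeval_X, map_one, sub_eq_zero,
    (isPrimitiveRoot_root hf hd h).pow_eq_one_iff_dvd]

theorem multiplicity_X_pow_sub_one (p : ℕ) [CharP F p] [hp : Fact p.Prime] {f : F[X]}
    (hf : Irreducible f) {k : ℕ} (hk : k ≠ 0) (h : f ∣ X ^ k - 1) :
    f ^ p ^ padicValNat p k ∣ X ^ k - 1 ∧ ¬ f ^ (p ^ padicValNat p k + 1) ∣ X ^ k - 1 := by
  have : ExpChar F[X] p := ExpChar.prime hp.out
  obtain ⟨m, hm⟩ : p ^ padicValNat p k ∣ k := pow_padicValNat_dvd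
  have hpm : ¬ p ∣ m := by
    rintro ⟨m', rfl⟩
    refine pow_succ_padicValNat_not_dvd (p := p) hk ⟨m', ?_⟩
    rw [pow_succ, mul_assoc, ← hm]
  have hfac : (X : F[X]) ^ k - 1 = (X ^ m - 1) ^ p ^ padicValNat p k := by
    rw [sub_pow_expChar_pow, one_pow, ← pow_mul, mul_comm m, ← hm]
  have hsep : (X ^ m - 1 : F[X]).Separable := by
    rw [X_pow_sub_one_separable_iff]
    exact fun h0 => hpm ((CharP.cast_eq_zero_iff F p m).1 h0)
  rw [hfac] at h ⊢
  obtain ⟨v, hv⟩ := hf.prime.dvd_of_dvd_pow h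
  have hfv : ¬ f ∣ v := by
    intro hfv
    exact hf.not_isUnit (hsep.squarefree f (by rw [hv]; exact mul_dvd_mul_left f hfv))
  rw [hv, mul_pow]
  refine ⟨dvd_mul_right _ _, fun h2 => hfv ?_⟩
  rw [pow_succ, mul_dvd_mul_iff_left (pow_ne_zero _ hf.ne_zero)] at h2
  exact hf.prime.dvd_of_dvd_pow h2

variable [Finite F]

theorem cast_ne_zero_of_mem_D {q n d : ℕ} (hq : Nat.card F = q) (hd : d ∈ D q n) :
    (d : F) ≠ 0 := by
  have hq1 : 2 ≤ q := hq ▸ Finite.one_lt_card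
  obtain ⟨-, i, hi, -, hdvd⟩ := (mem_D hq1).1 hd
  obtain ⟨c, hc⟩ := hdvd
  intro h0
  have : (q : F) = 0 := by
    rw [← hq]
    have := Fintype.ofFinite F
    rw [Nat.card_eq_fintype_card]
    exact FiniteField.cast_card_eq_zero F
  have h1 : ((q ^ i - 1 : ℕ) : F) = -1 := by
    rw [Nat.cast_sub (Nat.one_le_pow _ _ (by omega)), Nat.cast_pow, this, zero_pow (by omega)]
    simp
  rw [hc, Nat.cast_mul, h0, zero_mul] at h1
  exact one_ne_zero (neg_eq_zero.1 h1.symm)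

open UniqueFactorizationMonoid in
theorem cyclotomic_factors_of_mem_D {q n d : ℕ} (p : ℕ) [CharP F p] (hq : Nat.card F = q)
    (hd : d ∈ D q n) [DecidableEq F] :
    (normalizedFactors (cyclotomic d F)).toFinset.card = psi q d ∧
      ∀ f ∈ normalizedFactors (cyclotomic d F), f.natDegree = ordMod q d := by
  have := Fintype.ofFinite F
  obtain ⟨f, hp, hf⟩ := FiniteField.card F p
  have : Fact p.Prime := ⟨hp⟩
  have hpd : p.Coprime d := by
    rw [hp.coprime_iff_not_dvd, ← CharP.cast_eq_zero_iff F p]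
    exact cast_ne_zero_of_mem_D hq hd
  have hord : orderOf (ZMod.unitOfCoprime _ (hpd.pow_left (f : ℕ))) = ordMod q d := by
    rw [ordMod, ← orderOf_units, ZMod.coe_unitOfCoprime, ← hf, ← Nat.card_eq_fintype_card, hq]
  refine ⟨?_, fun g hg => ?_⟩
  · rw [normalizedFactors_cyclotomic_card hf hpd, hord, psi]
  · rw [natDegree_of_mem_normalizedFactors_cyclotomic hf hpd hg, hord]

/-- Labels for the irreducible polynomials other than `X`: `none` stands for `X - 1`. -/
abbrev PrimeLabel (q n : ℕ) : Type := Option (Σ d : D q n, Fin (psi q d))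

/-- A system of representatives of the irreducible polynomials other than `X` of degree at
most `n`. -/
structure PrimeSystem (F : Type*) [Field F] (q n : ℕ) where
  poly : PrimeLabel q n → F[X]
  irreducible : ∀ j, Irreducible (poly j)
  eq_of_dvd : ∀ i j, poly i ∣ poly j → i = j
  not_dvd_X : ∀ j, ¬ poly j ∣ X
  poly_none : poly none = X - 1
  natDegree_some : ∀ d i, (poly (some ⟨d, i⟩)).natDegree = ordMod q d
  dvd_iff : ∀ d i k, poly (some ⟨d, i⟩) ∣ X ^ k - 1 ↔ (d : ℕ) ∣ k
  complete : ∀ f : F[X], Irreducible f → ¬ f ∣ X → f.natDegree ≤ n → ∃ j, Associated f (poly j)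

open UniqueFactorizationMonoid in
theorem nonempty_primeSystem {q : ℕ} (n p : ℕ) [CharP F p] (hq : Nat.card F = q) :
    Nonempty (PrimeSystem F q n) := by
  classical
  have hq1 : 2 ≤ q := hq ▸ Finite.one_lt_card
  have hε : ∀ d : D q n, Nonempty (Fin (psi q d) ≃ (normalizedFactors (cyclotomic d F)).toFinset) :=
    fun d => ⟨Fintype.equivOfCardEq (by
      rw [Fintype.card_fin, Fintype.card_coe, (cyclotomic_factors_of_mem_D p hq d.2).1])⟩
  let ε := fun d => (hε d).some
  let P : PrimeLabel q n → F[X] := fun j => j.elim (X - 1) fun z => (ε z.1 z.2).1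
  have hmem : ∀ (d : D q n) i, P (some ⟨d, i⟩) ∈ normalizedFactors (cyclotomic (d : ℕ) F) :=
    fun d i => Multiset.mem_toFinset.1 (ε d i).2
  have hirr : ∀ j, Irreducible (P j) := by
    rintro (_ | ⟨d, i⟩)
    · have := irreducible_X_sub_C (1 : F)
      rwa [C_1] at this
    · exact irreducible_of_normalized_factor _ (hmem d i)
  have hiff : ∀ (d : D q n) i k, P (some ⟨d, i⟩) ∣ X ^ k - 1 ↔ (d : ℕ) ∣ k := fun d i k =>
    dvd_X_pow_sub_one_iff (hirr _) (cast_ne_zero_of_mem_D hq d.2)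
      (dvd_of_mem_normalizedFactors (hmem d i)) k
  let δ : PrimeLabel q n → ℕ := fun j => j.elim 1 fun z => z.1
  have hδ : ∀ j k, P j ∣ X ^ k - 1 ↔ δ j ∣ k := by
    rintro (_ | ⟨d, i⟩) k
    · have h1 : (X - 1 : F[X]) ∣ X ^ k - 1 := by simpa using sub_dvd_pow_sub_pow (X : F[X]) 1 k
      exact ⟨fun _ => one_dvd k, fun _ => h1⟩
    · exact hiff d i k
  have hδ0 : ∀ j, δ j ≠ 0 := by
    rintro (_ | ⟨d, i⟩)
    · exact one_ne_zero
    · have := ((mem_D hq1).1 d.2).1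
      exact (show (d : ℕ) ≠ 0 by omega)
  refine ⟨P, hirr, ?_, ?_, rfl, fun d i => (cyclotomic_factors_of_mem_D p hq d.2).2 _ (hmem d i),
    hiff, ?_⟩
  · intro i j hij
    have hass : Associated (P i) (P j) := (hirr i).associated_of_dvd (hirr j) hij
    have hδij : δ i = δ j := Nat.dvd_antisymm
      ((hδ i _).1 (hij.trans ((hδ j _).2 dvd_rfl)))
      ((hδ j _).1 (hass.symm.dvd.trans ((hδ i _).2 dvd_rfl)))
    rcases i with _ | ⟨d, i⟩ <;> rcases j with _ | ⟨d', j⟩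
    · rfl
    · have := ((mem_D hq1).1 d'.2).1
      have h2 : 1 = (d' : ℕ) := hδij
      omega
    · have := ((mem_D hq1).1 d.2).1
      have h2 : (d : ℕ) = 1 := hδij
      omega
    · obtain rfl : d = d' := Subtype.ext hδij
      have h3 : P (some ⟨d, i⟩) = P (some ⟨d, j⟩) := by
        rw [← normalize_normalized_factor _ (hmem d i), ← normalize_normalized_factor _ (hmem d j)]
        exact normalize_eq_normalize hass.dvd hass.symm.dvd
      have h4 : i = j := (ε d).injective (Subtype.ext h3)
      rw [h4]
  · intro j hX
    have h1 := (hδ j _).2 dvd_rfl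
    have h2 : P j ∣ X ^ δ j := dvd_pow hX (hδ0 j)
    have h3 := dvd_sub h2 h1
    rw [sub_sub_cancel] at h3
    exact (hirr j).not_isUnit (isUnit_of_dvd_one h3)
  · intro f hf hfX hfn
    have : Fact (Irreducible f) := ⟨hf⟩
    have hfin : Finite (AdjoinRoot f) := finite_cyc hf.ne_zero
    have hcard : Nat.card (AdjoinRoot f) = q ^ f.natDegree := by
      rw [← hq]; exact card_cyc hf.ne_zero
    have := Fintype.ofFinite (AdjoinRoot f)
    set ζ := AdjoinRoot.root f with hζdef
    have hζ0 : ζ ≠ 0 := by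
      intro h0
      apply hfX
      rw [dvd_iff_aeval_root, aeval_X, ← hζdef, h0]
    have hζq : ζ ^ (q ^ f.natDegree - 1) = 1 := by
      rw [← hcard, Nat.card_eq_fintype_card]
      exact FiniteField.pow_card_sub_one_eq_one ζ hζ0
    have hdvd : orderOf ζ ∣ q ^ f.natDegree - 1 := orderOf_dvd_of_pow_eq_one hζq
    have hpos : 0 < orderOf ζ := Nat.pos_of_dvd_of_pos hdvd (by
      have := Nat.one_lt_pow hf.natDegree_pos.ne' (show 1 < q by omega)
      omega)
    rcases Nat.lt_or_ge 1 (orderOf ζ) with h1 | h1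
    · have hD : orderOf ζ ∈ D q n := (mem_D hq1).2 ⟨h1, f.natDegree, hf.natDegree_pos, hfn, hdvd⟩
      have hroot := (IsPrimitiveRoot.orderOf ζ).isRoot_cyclotomic hpos
      have hfc : f ∣ cyclotomic (orderOf ζ) F := by
        rw [dvd_iff_aeval_root, ← eval_map_algebraMap, map_cyclotomic]
        exact hroot
      obtain ⟨g, hg, hfg⟩ := exists_mem_normalizedFactors_of_dvd (cyclotomic_ne_zero _ F) hf hfc
      let d : D q n := ⟨orderOf ζ, hD⟩
      refine ⟨some ⟨d, (ε d).symm ⟨g, Multiset.mem_toFinset.2 hg⟩⟩, ?_⟩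
      have : P (some ⟨d, (ε d).symm ⟨g, Multiset.mem_toFinset.2 hg⟩⟩) = g := by
        change ((ε d) ((ε d).symm _)).1 = g
        rw [Equiv.apply_symm_apply]
      rw [this]
      exact hfg
    · refine ⟨none, hf.associated_of_dvd (hirr none) ?_⟩
      have h2 : ζ = 1 := orderOf_eq_one_iff.1 (by omega)
      change f ∣ X - 1
      rw [dvd_iff_aeval_root, map_sub, aeval_X, map_one, ← hζdef, h2, sub_self]

end IrreducibleFactors

section Sorting


/-- Sorting tuples with respect to a strict total order; the fibres of the sorting map are counted
by multinomial coefficients. -/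
theorem exists_sort {α : Type*} [DecidableEq α] (r : α → α → Prop) [IsStrictTotalOrder α r]
    (m : ℕ) :
    ∃ sort : (Fin m → α) → (Fin m → α), (∀ f, ∃ σ : Equiv.Perm (Fin m), sort f = f ∘ σ) ∧
      (∀ f i j, i < j → sort f i = sort f j ∨ r (sort f i) (sort f j)) ∧
      ∀ f, (∀ i j, i < j → f i = f j ∨ r (f i) (f j)) →
        Finite {g // sort g = f} ∧ Nat.card {g // sort g = f} = Nat.factorial m /
          ∏ a ∈ Finset.univ.image f, Nat.factorial (Finset.univ.filter fun i => f i = a).card := by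
  classical
  let : LinearOrder α := linearOrderOfSTO r
  have hmono : ∀ f : Fin m → α, Monotone f ↔ ∀ i j, i < j → f i = f j ∨ r (f i) (f j) := by
    intro f
    refine ⟨fun h i j hij => (h hij.le), fun h i j hij => ?_⟩
    rcases hij.eq_or_lt with rfl | hlt
    · exact le_rfl
    · exact h i j hlt
  refine ⟨fun f => f ∘ Tuple.sort f, fun f => ⟨_, rfl⟩,
    fun f => (hmono _).1 (Tuple.monotone_sort f), fun f hf => ?_⟩
  rw [← hmono] at hf
  have hfib : ∀ g : Fin m → α, g ∘ Tuple.sort g = f ↔ ∃ σ : Equiv.Perm (Fin m), f ∘ σ = g := by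
    intro g
    constructor
    · intro h
      refine ⟨(Tuple.sort g)⁻¹, ?_⟩
      rw [← h]
      funext i
      simp
    · rintro ⟨σ, rfl⟩
      have h1 := Tuple.monotone_sort (f ∘ σ)
      have h2 := Tuple.unique_monotone (f := f) (σ := σ * Tuple.sort (f ∘ σ)) (τ := 1) h1 hf
      exact h2
  let Φ : Equiv.Perm (Fin m) → {g : Fin m → α // g ∘ Tuple.sort g = f} :=
    fun σ => ⟨f ∘ σ, (hfib _).2 ⟨σ, rfl⟩⟩
  have hsurj : Function.Surjective Φ := by
    rintro ⟨g, hg⟩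
    obtain ⟨σ, rfl⟩ := (hfib g).1 hg
    exact ⟨σ, rfl⟩
  have hfin : Finite {g : Fin m → α // g ∘ Tuple.sort g = f} := Finite.of_surjective Φ hsurj
  refine ⟨hfin, ?_⟩
  have := Fintype.ofFinite {g : Fin m → α // g ∘ Tuple.sort g = f}
  have hstab := DomMulAct.stabilizer_card' f
  simp only [Fintype.card_subtype] at hstab
  have hcard : Nat.factorial m = Nat.card {g : Fin m → α // g ∘ Tuple.sort g = f} *
      Nat.card {σ : Equiv.Perm (Fin m) // f ∘ σ = f} := by
    have h1 : Nat.factorial m = Nat.card (Equiv.Perm (Fin m)) := by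
      rw [Nat.card_perm, Nat.card_fin]
    rw [h1, Nat.card_congr (Equiv.sigmaFiberEquiv Φ).symm, Nat.card_sigma,
      Finset.sum_const_nat (m := Nat.card {σ : Equiv.Perm (Fin m) // f ∘ σ = f}),
      Finset.card_univ, Nat.card_eq_fintype_card (α := {g : Fin m → α // g ∘ Tuple.sort g = f})]
    intro g _
    obtain ⟨τ, rfl⟩ := hsurj g
    refine Nat.card_congr ((Equiv.mulRight τ⁻¹).subtypeEquiv fun σ => ?_)
    rw [Subtype.ext_iff]
    change f ∘ σ = f ∘ τ ↔ f ∘ (σ * τ⁻¹ : Equiv.Perm (Fin m)) = f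
    constructor
    · intro h
      funext i
      have := congrFun h (τ⁻¹ i)
      simpa using this
    · intro h
      funext i
      have := congrFun h (τ i)
      simpa using this
  rw [Nat.card_eq_fintype_card (α := {σ : Equiv.Perm (Fin m) // f ∘ σ = f}), Fintype.card_subtype,
    hstab] at hcard
  refine (Nat.div_eq_of_eq_mul_left (Finset.prod_pos fun a _ => Nat.factorial_pos _) hcard).symm

theorem Ptn.exists_max_ne {lam eta : Ptn} (h : lam ≠ eta) :
    ∃ i, lam i ≠ eta i ∧ ∀ j, i < j → lam j = eta j := by
  have hne : (Finsupp.neLocus lam eta).Nonempty := Finsupp.nonempty_neLocus_iff.2 h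
  refine ⟨(Finsupp.neLocus lam eta).max' hne, Finsupp.mem_neLocus.1 (Finset.max'_mem _ hne),
    fun j hj => ?_⟩
  by_contra hj'
  exact (Finset.le_max' _ j (Finsupp.mem_neLocus.2 hj')).not_gt hj

instance : IsStrictTotalOrder Ptn Ptn.Less where
  irrefl lam h := by
    rcases h with h | ⟨-, i, hi, -⟩
    · exact lt_irrefl _ h
    · exact lt_irrefl _ hi
  trans a b c hab hbc := by
    rcases hab with hab | ⟨hab, i, hi, hi'⟩ <;> rcases hbc with hbc | ⟨hbc, j, hj, hj'⟩
    · exact Or.inl (hab.trans hbc)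
    · exact Or.inl (hbc ▸ hab)
    · exact Or.inl (hab ▸ hbc)
    · refine Or.inr ⟨hab.trans hbc, max i j, ?_, fun k hk => ?_⟩
      · rcases lt_trichotomy i j with h | rfl | h
        · rw [max_eq_right h.le, hi' j h]; exact hj
        · rw [max_self]; exact hi.trans hj
        · rw [max_eq_left h.le, ← hj' i h]; exact hi
      · rw [hi' k ((le_max_left _ _).trans_lt hk), hj' k ((le_max_right _ _).trans_lt hk)]
  trichotomous a b hab hba := by
    by_contra hne
    have hsize : a.size = b.size := by
      rcases lt_trichotomy a.size b.size with h | h | h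
      · exact absurd (Or.inl h) hab
      · exact h
      · exact absurd (Or.inl h) hba
    obtain ⟨i, hi, hi'⟩ := Ptn.exists_max_ne hne
    rcases lt_or_gt_of_ne hi with h | h
    · exact hab (Or.inr ⟨hsize, i, h, hi'⟩)
    · exact hba (Or.inr ⟨hsize.symm, i, h, fun j hj => (hi' j hj).symm⟩)

variable {q n : ℕ}

/-- Equality up to permuting each tuple of partitions. -/
def Rearr (w w' : Datum q n) : Prop :=
  w'.1 = w.1 ∧ ∀ d : D q n, ∃ σ : Equiv.Perm (Fin (psi q d)), w'.2 d = w.2 d ∘ σ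

theorem exists_sort_datum (q n : ℕ) :
    ∃ sort : Datum q n → Datum q n, (∀ w, Rearr w (sort w)) ∧
      (∀ w (d : D q n), (sort w).2 d ∈ LamSet q d) ∧
      ∀ w, (∀ d : D q n, w.2 d ∈ LamSet q d) →
        Finite {v // sort v = w} ∧ Nat.card {v // sort v = w} = mult w := by
  choose s h1 h2 h3 using fun d : D q n => exists_sort Ptn.Less (psi q d)
  refine ⟨fun w => (w.1, fun d => s d (w.2 d)), fun w => ⟨rfl, fun d => h1 d _⟩,
    fun w d => h2 d _, fun w hw => ?_⟩
  have := fun d => (h3 d _ (hw d)).1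
  have e : {v : Datum q n // (v.1, fun d => s d (v.2 d)) = w} ≃
      ∀ d, {g // s d g = w.2 d} :=
    { toFun := fun v d => ⟨v.1.2 d, congrFun (congrArg Prod.snd v.2) d⟩
      invFun := fun g => ⟨(w.1, fun d => (g d).1), Prod.ext rfl (funext fun d => (g d).2)⟩
      left_inv := fun v => Subtype.ext (Prod.ext (congrArg Prod.fst v.2).symm rfl)
      right_inv := fun g => rfl }
  refine ⟨Finite.of_equiv _ e.symm, ?_⟩
  rw [Nat.card_congr e, Nat.card_pi, mult]
  exact Finset.prod_congr rfl fun d _ => (h3 d _ (hw d)).2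

namespace Rearr

variable {w w' : Datum q n} (h : Rearr w w')

include h

theorem sum_eq (d : D q n) (g : Ptn → ℕ) : ∑ i, g (w'.2 d i) = ∑ i, g (w.2 d i) := by
  obtain ⟨σ, hσ⟩ := h.2 d
  rw [hσ]
  exact Equiv.sum_comp σ fun i => g (w.2 d i)

theorem tupSize_eq (d : D q n) : tupSize (w'.2 d) = tupSize (w.2 d) := h.sum_eq d Ptn.size

theorem topD_eq : topD w' = topD w := by
  refine Finset.sup_congr rfl fun d _ => ?_
  obtain ⟨σ, hσ⟩ := h.2 d
  rw [hσ]
  refine le_antisymm (Finset.sup_le fun i _ => ?_) (Finset.sup_le fun i _ => ?_)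
  · exact Finset.le_sup (f := fun i => (w.2 d i).top) (Finset.mem_univ (σ i))
  · have := Finset.le_sup (f := fun i => (w.2 d (σ i)).top) (Finset.mem_univ (σ⁻¹ i))
    simpa using! this

theorem quadTotal_eq : quadTotal w' = quadTotal w := by
  rw [quadTotal, quadTotal, h.1]
  simp only [h.sum_eq _ Ptn.quad]

theorem eulerTotal_eq : eulerTotal w' = eulerTotal w := by
  rw [eulerTotal, eulerTotal, h.1]
  congr 1
  refine Finset.prod_congr rfl fun d _ => ?_
  obtain ⟨σ, hσ⟩ := h.2 d
  rw [hσ]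
  exact Equiv.prod_comp σ fun i => (w.2 d i).euler q (ordMod q d)

theorem fixExp_eq (p k : ℕ) : fixExp p k w' = fixExp p k w := by
  rw [fixExp, fixExp, h.1]
  simp only [h.sum_eq _ (Ptn.minSum _)]

theorem b1_eq (p : ℕ) : b1 p w' = b1 p w := by
  rw [b1, b1, h.1, h.topD_eq]
  simp only [h.tupSize_eq]

theorem b2_eq (p : ℕ) (t : ℕ+) : b2 p t w' = b2 p t w := by
  rw [b2, b2, h.b1_eq, h.1, h.topD_eq]

theorem e1_eq (p : ℕ) : e1 p w' = e1 p w := by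
  rw [e1, e1, h.b1_eq]
  simp only [h.fixExp_eq]

theorem e2_eq (p : ℕ) (t : ℕ+) : e2 p t w' = e2 p t w := by
  rw [e2, e2, h.b2_eq]
  simp only [h.fixExp_eq]

end Rearr

end Sorting

section DatumModule

open Polynomial

variable {F : Type*} [Field F] {q n : ℕ}

/-- The family of partitions attached to a datum. -/
def lamOf (w : Datum q n) : PrimeLabel q n → Ptn := fun j => j.elim w.1 fun z => w.2 z.1 z.2

/-- The total size `|lam| + ∑_d o_d(q) |Lam_d|`. -/
noncomputable def dataSize (w : Datum q n) : ℕ :=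
  w.1.size + ∑ d : D q n, ordMod q d * tupSize (w.2 d)

theorem exists_lamOf_eq (lam : PrimeLabel q n → Ptn) : ∃ w : Datum q n, lamOf w = lam := by
  refine ⟨(lam none, fun d i => lam (some ⟨d, i⟩)), funext fun j => ?_⟩
  rcases j with _ | ⟨d, i⟩ <;> rfl

theorem lamOf_injective : Function.Injective (lamOf (q := q) (n := n)) := by
  intro w w' h
  refine Prod.ext (congrFun h none) (funext fun d => funext fun i => ?_)
  exact congrFun h (some ⟨d, i⟩)

theorem Rearr.dataSize_eq {w w' : Datum q n} (h : Rearr w w') : dataSize w' = dataSize w := by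
  rw [dataSize, dataSize, h.1]
  simp only [h.tupSize_eq]

variable (S : PrimeSystem F q n)

theorem PrimeSystem.natDegree_none : (S.poly none).natDegree = 1 := by
  rw [S.poly_none, ← C_1, natDegree_X_sub_C]

theorem sum_natDegree_mul (w : Datum q n) (g : Ptn → ℕ) :
    ∑ j, (S.poly j).natDegree * g (lamOf w j) =
      g w.1 + ∑ d : D q n, ordMod q d * ∑ i, g (w.2 d i) := by
  rw [Fintype.sum_option, Fintype.sum_sigma, S.natDegree_none, one_mul]
  congr 1
  refine Finset.sum_congr rfl fun d _ => ?_
  rw [Finset.mul_sum]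
  refine Finset.sum_congr rfl fun i _ => ?_
  rw [S.natDegree_some]
  rfl

theorem sum_natDegree_mul_size (w : Datum q n) :
    ∑ j, (S.poly j).natDegree * (lamOf w j).size = dataSize w :=
  sum_natDegree_mul S w Ptn.size

variable [Finite F] (hq : Nat.card F = q)

include hq

theorem card_aut_lamOf (w : Datum q n) :
    (Nat.card (PMod S.poly (lamOf w) ≃ₗ[F[X]] PMod S.poly (lamOf w)) : ℝ) =
      (q : ℝ) ^ quadTotal w * eulerTotal w := by
  have heuler : ∀ (c : ℕ) (lam : Ptn), ∏ e ∈ lam.support, ∏ u ∈ Finset.Icc 1 (lam e),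
      (1 - (((q : ℝ) ^ c) ^ u)⁻¹) = lam.euler q c := by
    intro c lam
    refine Finset.prod_congr rfl fun e _ => Finset.prod_congr rfl fun u _ => ?_
    rw [zpow_neg, zpow_natCast, pow_mul]
  rw [card_aut_pmod S.irreducible S.eq_of_dvd, Finset.prod_mul_distrib, hq]
  simp only [← pow_mul, Finset.prod_pow_eq_pow_sum] at heuler ⊢
  rw [sum_natDegree_mul S w Ptn.quad]
  congr 1
  simp only [heuler]
  rw [Fintype.prod_option, Fintype.prod_sigma, S.natDegree_none]
  simp only [S.natDegree_some]
  rfl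

variable (p : ℕ) [CharP F p] [hp : Fact p.Prime]

include hp in
theorem torCard_lamOf_X_pow_sub_one (w : Datum q n) {k : ℕ} (hk : k ≠ 0) :
    torCard (PMod S.poly (lamOf w)) (X ^ k - 1 : F[X]) = q ^ fixExp p k w := by
  classical
  rw [torCard_pmod S.irreducible (lamOf w) _
    (fun j => if S.poly j ∣ X ^ k - 1 then p ^ padicValNat p k else 0), hq]
  · simp only [← pow_mul]
    rw [Finset.prod_pow_eq_pow_sum, Fintype.sum_option, Fintype.sum_sigma, S.natDegree_none,
      one_mul, fixExp]
    congr 2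
    · rw [if_pos]
      · rfl
      · rw [S.poly_none]
        simpa using sub_dvd_pow_sub_pow (X : F[X]) 1 k
    · rw [Finset.sum_filter]
      refine Finset.sum_congr rfl fun d _ => ?_
      simp only [S.dvd_iff, S.natDegree_some]
      rw [← Finset.mul_sum]
      split_ifs with h
      · rfl
      · simp [Ptn.minSum]
  · intro j
    split_ifs with h
    · exact multiplicity_X_pow_sub_one p (S.irreducible j) hk h
    · simpa using h

theorem torCard_lamOf_X_sub_one_pow (w : Datum q n) (t : ℕ) :
    torCard (PMod S.poly (lamOf w)) ((X - 1) ^ t : F[X]) = q ^ w.1.minSum t := by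
  rw [← S.poly_none, torCard_pmod_pow S.irreducible S.eq_of_dvd, S.natDegree_none, pow_one, hq]
  rfl

end DatumModule

section Exponents

variable {q n : ℕ} (p : ℕ)

theorem top_le_topD (w : Datum q n) (d : D q n) (i : Fin (psi q d)) : (w.2 d i).top ≤ topD w :=
  (Finset.le_sup (f := fun i => (w.2 d i).top) (Finset.mem_univ i)).trans
    (Finset.le_sup (f := fun d : D q n => tupTop (w.2 d)) (Finset.mem_univ d))

theorem fixExp_eq_dataSize {w : Datum q n} {k : ℕ}
    (h1 : max w.1.top (topD w) ≤ p ^ padicValNat p k)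
    (h2 : ∀ d : D q n, 0 < tupSize (w.2 d) → (d : ℕ) ∣ k) : fixExp p k w = dataSize w := by
  rw [fixExp, dataSize, Ptn.minSum_of_top_le ((le_max_left _ _).trans h1)]
  congr 1
  have h3 : ∀ d : D q n, ∑ i, (w.2 d i).minSum (p ^ padicValNat p k) = tupSize (w.2 d) := fun d =>
    Finset.sum_congr rfl fun i _ =>
      Ptn.minSum_of_top_le ((top_le_topD w d i).trans ((le_max_right _ _).trans h1))
  simp only [h3]
  rw [Finset.sum_filter_of_ne]
  intro d _ hd
  exact h2 d (Nat.pos_of_ne_zero (right_ne_zero_of_mul hd))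

variable {p} (hp : p.Prime) (hD : ∀ d ∈ D q n, ¬ p ∣ d)

include hp hD

theorem not_dvd_lcm (w : Datum q n) :
    ¬ p ∣ (Finset.univ.filter fun d : D q n => 0 < tupSize (w.2 d)).lcm (fun d => (d : ℕ)) := by
  intro h
  have h1 := h.trans (Finset.lcm_dvd fun d hd => Finset.dvd_prod_of_mem (fun d : D q n => (d : ℕ)) hd)
  obtain ⟨d, -, hd⟩ := (hp.prime.dvd_finsetProd_iff _).1 h1
  exact hD d d.2 hd

theorem lcm_ne_zero (w : Datum q n) :
    (Finset.univ.filter fun d : D q n => 0 < tupSize (w.2 d)).lcm (fun d => (d : ℕ)) ≠ 0 :=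
  fun h => not_dvd_lcm hp hD w (by rw [h]; exact dvd_zero p)

theorem b1_ne_zero (w : Datum q n) : b1 p w ≠ 0 :=
  mul_ne_zero (lcm_ne_zero hp hD w) (pow_ne_zero _ hp.ne_zero)

theorem padicValNat_b1 (w : Datum q n) :
    padicValNat p (b1 p w) = Nat.clog p (max w.1.top (topD w)) := by
  have : Fact p.Prime := ⟨hp⟩
  rw [b1, padicValNat.mul (lcm_ne_zero hp hD w)
    (pow_ne_zero _ hp.ne_zero), padicValNat.eq_zero_of_not_dvd (not_dvd_lcm hp hD w),
    padicValNat.prime_pow, zero_add]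

theorem fixExp_of_b1_dvd (w : Datum q n) {k : ℕ} (hk : k ≠ 0) (h : b1 p w ∣ k) :
    fixExp p k w = dataSize w := by
  have : Fact p.Prime := ⟨hp⟩
  refine fixExp_eq_dataSize p ?_ fun d hd => ?_
  · refine (Nat.le_pow_clog hp.one_lt _).trans (Nat.pow_le_pow_right hp.pos ?_)
    rw [← padicValNat_b1 hp hD]
    exact (padicValNat_dvd_iff_le hk).1 (pow_padicValNat_dvd.trans h)
  · refine Dvd.dvd.trans ?_ h
    exact (Finset.dvd_lcm (f := fun d : D q n => (d : ℕ))
      (Finset.mem_filter.2 ⟨Finset.mem_univ d, hd⟩)).mul_right _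

theorem b2_ne_zero (t : ℕ+) (w : Datum q n) : b2 p t w ≠ 0 := by
  rw [b2]
  refine mul_ne_zero (b1_ne_zero hp hD w) ?_
  split_ifs
  · exact hp.ne_zero
  · exact one_ne_zero

theorem lt_pow_padicValNat_b2 {t : ℕ+} {w : Datum q n} (ht : t ∈ w.1.support) :
    (t : ℕ) < p ^ padicValNat p (b2 p t w) := by
  have : Fact p.Prime := ⟨hp⟩
  have htop : (t : ℕ) ≤ w.1.top := Finset.le_sup (f := fun i : ℕ+ => (i : ℕ)) ht
  have hle : max w.1.top (topD w) ≤ p ^ Nat.clog p (max w.1.top (topD w)) :=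
    Nat.le_pow_clog hp.one_lt _
  have h1 := le_max_left w.1.top (topD w)
  rw [b2]
  split_ifs with h
  · rw [padicValNat.mul (b1_ne_zero hp hD w) hp.ne_zero, padicValNat_b1 hp hD, padicValNat_self,
      pow_succ]
    have := hp.one_lt
    have := (Nat.lt_mul_iff_one_lt_right
      (pow_pos hp.pos (Nat.clog p (max w.1.top (topD w))))).2 this
    omega
  · rw [mul_one, padicValNat_b1 hp hD]
    refine lt_of_le_of_ne (htop.trans (h1.trans hle)) fun heq => h ⟨?_, ?_, _, heq⟩
    · omega
    · have := le_max_right w.1.top (topD w)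
      omega

end Exponents

section Count

open Polynomial

variable {F : Type*} [Field F] [Finite F] {q n : ℕ} (p : ℕ) [CharP F p]

/-- The contribution of all translations over one linear automorphism of type `w`. -/
noncomputable def transSum (p : ℕ) (w : Datum q n) : ℝ :=
  (q : ℝ) ^ n * (((q : ℝ) ^ w.1.len)⁻¹ * (q : ℝ) ^ e1 p w +
    ∑ t ∈ w.1.support, ((q : ℝ) ^ w.1 t - 1) / (q : ℝ) ^ w.1.lenFrom t * (q : ℝ) ^ e2 p t w)

theorem sum_translations (hq : Nat.card F = q) (S : PrimeSystem F q n)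
    {T : (Fin n → F) ≃ₗ[F] (Fin n → F)} {w : Datum q n}
    (l : Module.AEval' (T : Module.End F (Fin n → F)) ≃ₗ[F[X]] PMod S.poly (lamOf w))
    [Fintype (Fin n → F)] :
    ∑ a, (Nat.card {f : (Fin n → F) → F // ∀ x, f (affPerm T a x) = f x} : ℝ) = transSum p w := by
  classical
  have hp' : p.Prime := (CharP.char_is_prime_or_zero F p).resolve_right (CharP.char_ne_zero_of_finite F p)
  have hp : Fact p.Prime := ⟨hp'⟩
  have hq0 : 1 < q := hq ▸ Finite.one_lt_card
  have hD : ∀ d ∈ D q n, ¬ p ∣ d := fun d hd h =>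
    cast_ne_zero_of_mem_D (F := F) hq hd ((CharP.cast_eq_zero_iff F p d).2 h)
  have hVcard : Nat.card (Fin n → F) = q ^ n := by rw [Nat.card_fun, hq, Nat.card_fin]
  have hker : ∀ k, k ≠ 0 → Nat.card (LinearMap.ker ((T : Module.End F (Fin n → F)) ^ k - 1)) =
      q ^ fixExp p k w := by
    intro k hk
    rw [← torCard_lamOf_X_pow_sub_one S hq p w hk, ← torCard_congr l, torCard_aeval]
    simp
  have hkerN : ∀ t, Nat.card (LinearMap.ker (((T : Module.End F (Fin n → F)) - 1) ^ t)) =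
      q ^ w.1.minSum t := by
    intro t
    rw [← torCard_lamOf_X_sub_one_pow S hq w t, ← torCard_congr l, torCard_aeval]
    simp
  have hsize : dataSize w = n := by
    rw [← sum_natDegree_mul_size S, sum_size_eq_finrank S.irreducible l, Module.finrank_fin_fun]
  have hone : ∀ k, k ≠ 0 → b1 p w ∣ k → (T : Module.End F (Fin n → F)) ^ k = 1 := by
    intro k hk hdvd
    have h1 := hker k hk
    rw [fixExp_of_b1_dvd hp' hD w hk hdvd, hsize, ← hVcard] at h1
    have h2 : (LinearMap.ker ((T : Module.End F (Fin n → F)) ^ k - 1) : Set (Fin n → F)) =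
        Set.univ :=
      Set.eq_of_subset_of_ncard_le (Set.subset_univ _) (by
        rw [Set.ncard_univ, ← h1]; exact le_rfl) (Set.toFinite _)
    refine sub_eq_zero.1 (LinearMap.ext fun x => ?_)
    have : x ∈ (LinearMap.ker ((T : Module.End F (Fin n → F)) ^ k - 1) : Set (Fin n → F)) :=
      h2 ▸ Set.mem_univ x
    exact this
  set U := transSpace (T : Module.End F (Fin n → F)) with hU
  have hUcard : ∀ t, Nat.card (U t) * q ^ w.1.lenAbove t = Nat.card (Fin n → F) := by
    intro t
    have h1 := card_transSpace_mul (T : Module.End F (Fin n → F)) t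
    rw [hkerN, hkerN, Ptn.minSum_succ, pow_add, mul_comm (q ^ _), ← mul_assoc] at h1
    exact Nat.eq_of_mul_eq_mul_right (pow_pos (by omega) _) h1
  have hmono : Monotone U := transSpace_mono _
  rw [sum_filtration (q := q) (by omega) U hmono w.1 hUcard _ ((q : ℝ) ^ e1 p w)
    (fun t => (q : ℝ) ^ e2 p t w), hVcard, transSum, Nat.cast_pow]
  · intro a ha
    have hall : ∀ r, a ∈ U r := fun r => hmono (Nat.zero_le r) ha
    have hb := b1_ne_zero hp' hD w
    rw [card_invariant_functions (affPerm T a) (Nat.pos_of_ne_zero hb)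
      (affPerm_pow_eq_one p T a hb (hone _ hb dvd_rfl) (hall _)), hq, e1]
    congr 2
    refine Finset.sum_congr rfl fun k hk => ?_
    have hk0 : k ≠ 0 := (Nat.pos_of_mem_divisors hk).ne'
    rw [card_fixed_points p T a hk0, if_pos (hall _), hker k hk0, Nat.cast_pow]
  · intro t a ht ha ha'
    have hmem : ∀ r, a ∈ U r ↔ (t : ℕ) ≤ r := by
      intro r
      refine ⟨fun h => ?_, fun h => hmono h ha⟩
      by_contra hlt
      exact ha' (hmono (by omega) h)
    have hlevel : ∀ v, a ∈ U (p ^ v - 1) ↔ 1 + Nat.log p t ≤ v := by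
      intro v
      have := pow_pos hp'.pos v
      rw [hmem, show (t : ℕ) ≤ p ^ v - 1 ↔ (t : ℕ) < p ^ v by omega,
        ← Nat.log_lt_iff_lt_pow hp'.one_lt t.pos.ne', Nat.add_comm, Nat.succ_le_iff]
    have hb := b2_ne_zero hp' hD t w
    rw [card_invariant_functions (affPerm T a) (Nat.pos_of_ne_zero hb)
      (affPerm_pow_eq_one p T a hb (hone _ hb (Dvd.intro _ rfl)) (by
        rw [← hU, hmem]
        have := lt_pow_padicValNat_b2 hp' hD ht
        omega)), hq, e2]
    congr 2
    rw [Finset.sum_filter]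
    refine Finset.sum_congr rfl fun k hk => ?_
    have hk0 : k ≠ 0 := (Nat.pos_of_mem_divisors hk).ne'
    rw [card_fixed_points p T a hk0, ← hU, hker k hk0]
    simp only [hlevel]
    split_ifs
    · rw [Nat.cast_pow]
    · rw [Nat.cast_zero, mul_zero]

theorem Rearr.transSum_eq {w w' : Datum q n} (h : Rearr w w') : transSum p w' = transSum p w := by
  rw [transSum, transSum, h.1, h.e1_eq]
  simp only [h.e2_eq]

theorem numOrbits_eq_sum (hq : Nat.card F = q) :
    (numOrbits n F : ℝ) = ∑ w ∈ OmegaFin q n, (mult w : ℝ) *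
      (((q : ℝ) ^ quadTotal w * eulerTotal w)⁻¹ * (transSum p w / (q : ℝ) ^ n)) := by
  classical
  obtain ⟨S⟩ := nonempty_primeSystem (F := F) n p hq
  have hq0 : 1 < q := hq ▸ Finite.one_lt_card
  have := Fintype.ofFinite F
  have : Finite ((Fin n → F) ≃ₗ[F] (Fin n → F)) := DFunLike.finite _
  have := Fintype.ofFinite ((Fin n → F) ≃ₗ[F] (Fin n → F))
  have hex : ∀ T : (Fin n → F) ≃ₗ[F] (Fin n → F), ∃ w : Datum q n, Nonempty
      (Module.AEval' (T : Module.End F (Fin n → F)) ≃ₗ[F[X]] PMod S.poly (lamOf w)) := by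
    intro T
    obtain ⟨lam, hl⟩ := exists_aeval_equiv_pmod (P := S.poly) (fun f hf hfX hfn =>
      S.complete f hf hfX (by rwa [Module.finrank_fin_fun] at hfn)) T
    obtain ⟨w, rfl⟩ := exists_lamOf_eq lam
    exact ⟨w, hl⟩
  choose typ htyp using hex
  have htyp_iff : ∀ T w, typ T = w ↔ Nonempty
      (Module.AEval' (T : Module.End F (Fin n → F)) ≃ₗ[F[X]] PMod S.poly (lamOf w)) := by
    intro T w
    refine ⟨fun h => h ▸ htyp T, fun ⟨l⟩ => lamOf_injective ?_⟩
    exact pmod_equiv_unique S.irreducible S.eq_of_dvd ((htyp T).some.symm.trans l)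
  have htyp_size : ∀ T, dataSize (typ T) = n := fun T => by
    rw [← sum_natDegree_mul_size S, sum_size_eq_finrank S.irreducible (htyp T).some,
      Module.finrank_fin_fun]
  have haut : ∀ w : Datum q n, (q : ℝ) ^ quadTotal w * eulerTotal w ≠ 0 := by
    intro w
    have := finite_pmod S.irreducible (lamOf w)
    have : Finite (PMod S.poly (lamOf w) ≃ₗ[F[X]] PMod S.poly (lamOf w)) := DFunLike.finite _
    rw [← card_aut_lamOf S hq]
    exact_mod_cast (Nat.card_pos (α := PMod S.poly (lamOf w) ≃ₗ[F[X]] PMod S.poly (lamOf w))).ne'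
  have hclass : ∀ w : Datum q n, dataSize w = n → (Nat.card {T // typ T = w} : ℝ) =
      Nat.card ((Fin n → F) ≃ₗ[F] (Fin n → F)) * ((q : ℝ) ^ quadTotal w * eulerTotal w)⁻¹ := by
    intro w hw
    rw [← div_eq_mul_inv, eq_div_iff (haut w), ← card_aut_lamOf S hq,
      Nat.card_congr (Equiv.subtypeEquivRight fun T => htyp_iff T w)]
    exact_mod_cast card_type_mul_card_aut S.irreducible S.not_dvd_X
      (by rw [sum_natDegree_mul_size, hw, Module.finrank_fin_fun])
  obtain ⟨sort, hsort1, hsort2, hsort3⟩ := exists_sort_datum q n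
  have hmaps : ∀ T ∈ Finset.univ, sort (typ T) ∈ OmegaFin q n := by
    intro T _
    rw [OmegaFin, Set.Finite.mem_toFinset]
    exact ⟨fun d => hsort2 _ d, ((hsort1 _).dataSize_eq).trans (htyp_size T)⟩
  have hfib : ∀ w ∈ OmegaFin q n, (Nat.card {T // sort (typ T) = w} : ℝ) = mult w *
      (Nat.card ((Fin n → F) ≃ₗ[F] (Fin n → F)) * ((q : ℝ) ^ quadTotal w * eulerTotal w)⁻¹) := by
    intro w hw
    rw [OmegaFin, Set.Finite.mem_toFinset] at hw
    obtain ⟨hfin, hcard⟩ := hsort3 w hw.1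
    have := Fintype.ofFinite {v // sort v = w}
    have e : {T // sort (typ T) = w} ≃ Σ v : {v // sort v = w}, {T // typ T = v.1} :=
      { toFun := fun T => ⟨⟨typ T.1, T.2⟩, ⟨T.1, rfl⟩⟩
        invFun := fun z => ⟨z.2.1, by rw [z.2.2]; exact z.1.2⟩
        left_inv := fun T => rfl
        right_inv := by
          rintro ⟨⟨v, hv⟩, ⟨T, hT⟩⟩
          have hT' : typ T = v := hT
          subst hT'
          rfl }
    rw [Nat.card_congr e, Nat.card_sigma, Nat.cast_sum, Finset.sum_congr rfl fun v _ => ?_,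
      Finset.sum_const, Finset.card_univ, ← Nat.card_eq_fintype_card, hcard, nsmul_eq_mul]
    have hr := hsort1 v.1
    rw [v.2] at hr
    rw [hclass v.1 (hr.dataSize_eq.symm.trans hw.2), hr.quadTotal_eq, hr.eulerTotal_eq]
  have hmain := congrArg (Nat.cast (R := ℝ)) (numOrbits_mul_card (n := n) (F := F))
  simp only [finsum_eq_sum_of_fintype, Nat.cast_sum, Nat.cast_mul, Nat.cast_pow] at hmain
  have hGL : (Nat.card ((Fin n → F) ≃ₗ[F] (Fin n → F)) : ℝ) ≠ 0 := by
    exact_mod_cast (Nat.card_pos (α := (Fin n → F) ≃ₗ[F] (Fin n → F))).ne'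
  have hqn : (q : ℝ) ^ n ≠ 0 := pow_ne_zero _ (by exact_mod_cast (by omega : q ≠ 0))
  rw [hq] at hmain
  rw [eq_div_of_mul_eq (mul_ne_zero hGL hqn) hmain,
    Finset.sum_congr rfl fun T _ => sum_translations p hq S (htyp T).some,
    ← Finset.sum_fiberwise_of_maps_to hmaps, Finset.sum_div]
  refine Finset.sum_congr rfl fun w hw => ?_
  have hconst : ∀ T ∈ Finset.univ.filter (fun T => sort (typ T) = w),
      transSum p (typ T) = transSum p w := by
    intro T hT
    have hr := hsort1 (typ T)
    rw [(Finset.mem_filter.1 hT).2] at hr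
    exact (hr.transSum_eq p).symm
  rw [Finset.sum_congr rfl hconst, Finset.sum_const, nsmul_eq_mul, ← Fintype.card_subtype,
    ← Nat.card_eq_fintype_card, hfib w hw]
  field_simp

end Count

end AGLCount

theorem theorem3p1 (F : Type*) [Field F] [Finite F] (p q n : ℕ) [CharP F p]
    (hq : Nat.card F = q) :
    (AGLCount.numOrbits n F : ℝ) =
      (∑ w ∈ AGLCount.OmegaFin q n,
        (AGLCount.mult w : ℝ) * ((q : ℝ) ^ (AGLCount.e1 p w) / AGLCount.a1 w)) +
      ∑ w ∈ AGLCount.OmegaFin q n, ∑ t ∈ w.1.support,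
        (AGLCount.mult w : ℝ) * ((q : ℝ) ^ (AGLCount.e2 p t w) / AGLCount.a2 t w) := by
  rw [AGLCount.numOrbits_eq_sum p hq, ← Finset.sum_add_distrib]
  have hq0 : (q : ℝ) ≠ 0 := by
    rw [← hq]
    exact_mod_cast (Nat.card_pos (α := F)).ne'
  refine Finset.sum_congr rfl fun w _ => ?_
  rw [← Finset.mul_sum, ← mul_add, AGLCount.transSum, mul_div_cancel_left₀ _ (pow_ne_zero n hq0),
    mul_add, Finset.mul_sum]
  congr 2
  · rw [AGLCount.a1, pow_add, mul_assoc, div_eq_mul_inv, mul_inv, mul_inv]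
    ring
  · refine Finset.sum_congr rfl fun t _ => ?_
    rw [AGLCount.a2, pow_add, one_div]
    simp only [div_eq_mul_inv, mul_inv, inv_inv]
    ring
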